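/- Let $(\Omega,\mathcal F,\mathbb P)$ be a probability space and let $(\pi_j)_{j\in\mathbb Z}$ be a group of measure-preserving transformations acting ergodically on $\Omega$. Let $f:\mathbb Z\times[0,1]\times\Omega\to\mathbb R$ and $d:\mathbb Z\times\Omega\to\mathbb R$ be such that $f(i,s;\cdot)$ and $d_i(\cdot)=d(i,\cdot)$ are random variables. Fix $\alpha\in(0,1]$, write $c_i(\omega)=f_s'(i,0;\omega)$, and assume that for almost every $\omega$: - $0<\inf_i d_i(\omega)\le\sup_i d_i(\omega)<\infty$; - $f(i,\cdot\,;\omega)\in C^{1+\alpha}([0,1])$ with $\sup_i\|f(i,\cdot\,;\omega)\|_{C^{1+\alpha}}<\infty$; - $f(i,0;\omega)=f(i,1;\omega)=0$ for all $i$, and $0<\inf_j f(j,s;\omega)\le f(i,s;\omega)\le c_i(\omega)s$ for all $i$ and all $s\in(0,1)$; - $\liminf_{|i|\to\infty}\bigl(c_i(\omega)-(\sqrt{d_{i+1}(\omega)}-\sqrt{d_i(\omega)})^2\bigr)>0$; - $c_{i+j}(\omega)=c_i(\pi_j\omega)$ and $d_{i+j}(\omega)=d_i(\pi_j\omega)$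 for all $i,j\in\mathbb Z$. Let $(\mathcal L^\omega\phi)_i=d_{i+1}(\omega)(\phi_{i+1}-\phi_i)+d_i(\omega)(\phi_{i-1}-\phi_i)+c_i(\omega)\phi_i$ for $\phi:\mathbb Z\to\mathbb R$. For $l\in\mathbb Z$ and $k\ge1$, let $\Gamma_{l,k}(\omega)$ be the principal (that is, the largest) eigenvalue of $\mathcal L^\omega$ on $\{l+1,\dots,l+k\}$ with boundary conditions $\phi_l=\phi_{l+k+1}=0$. Then there is a deterministic constant $\Gamma_\infty\in\mathbb R$ such that, almost surely, $$\lim_{k\to\infty}\Gamma_{-k,2k}(\omega)=\lim_{k\to\infty}\Gamma_{-k,k}(\omega)=\lim_{k\to\infty}\Gamma_{0,k}(\omega)=\Gamma_\infty ,$$ and there is a deterministic function $\mu:(\Gamma_\infty,\infty)\to\mathbb R$ such that the following holds. There is a set of $\omega$ of probability one, not depending on $\gamma$, such that for every $\omega$ in it and every $\gamma>\Gamma_\infty$ the problem $$(\mathcal L^\omega u)_i-\gamma u_i=0\ \ (i\in\mathbb Z),\qquad u_0=1,\qquad \lim_{i\to+\infty}u_i=0$$ has a unique solution $u=u(\gamma,\omega):\mathbb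 Z\to\mathbb R$, this solution satisfies $u_i>0$ for all $i\in\mathbb Z$, and $$\lim_{i\to+\infty}\frac{-\ln u_i(\gamma,\omega)}{i}=\lim_{i\to-\infty}\frac{-\ln u_i(\gamma,\omega)}{i}=\mu(\gamma).$$ Moreover, $\mu$ is strictly increasing and concave on $(\Gamma_\infty,\infty)$, and $\mu(\gamma)\to+\infty$ as $\gamma\to+\infty$. -/

import Mathlib

open Filter Topology MeasureTheory Set

/-- The linear lattice operator
`(L φ)_i = d_{i+1} (φ_{i+1} - φ_i) + d_i (φ_{i-1} - φ_i) + c_i φ_i` on functions `φ : ℤ → ℝ`. -/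
def latticeOp (d c : ℤ → ℝ) (φ : ℤ → ℝ) (i : ℤ) : ℝ :=
  d (i + 1) * (φ (i + 1) - φ i) + d i * (φ (i - 1) - φ i) + c i * φ i

/-- `ev` is an eigenvalue of the operator on `{l+1, …, l+k}` with Dirichlet conditions
`φ_l = φ_{l+k+1} = 0`. -/
def IsDirichletEigenvalue (d c : ℤ → ℝ) (l : ℤ) (k : ℕ) (ev : ℝ) : Prop :=
  ∃ φ : ℤ → ℝ, φ l = 0 ∧ φ (l + k + 1) = 0 ∧
    (∃ i ∈ Icc (l + 1) (l + k), φ i ≠ 0) ∧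
    ∀ i ∈ Icc (l + 1) (l + k), latticeOp d c φ i = ev * φ i

/-- The principal (largest) eigenvalue `Γ_{l,k}` of the Dirichlet problem on `{l+1, …, l+k}`.
The problem is a symmetric tridiagonal `k × k` matrix problem, so its spectrum is real, finite, and
nonempty for `k ≥ 1`. -/
noncomputable def principalEigenvalue (d c : ℤ → ℝ) (l : ℤ) (k : ℕ) : ℝ :=
  sSup {ev : ℝ | IsDirichletEigenvalue d c l k ev}

/-- `u` solves `(L - γ) u = 0` on `ℤ`, with `u_0 = 1` and `u_i → 0` as `i → +∞`. -/
structure IsDecayingSolution (d c : ℤ → ℝ) (γ : ℝ) (u : ℤ → ℝ) : Prop where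
  eqn : ∀ i : ℤ, latticeOp d c u i - γ * u i = 0
  normalized : u 0 = 1
  decay : Tendsto u atTop (𝓝 0)

/-- The linear growth rates `c_i = ∂_s f(i, 0)`, for reaction terms `f(i, ·)` given on `[0, 1]`. -/
noncomputable def growthRate (f : ℤ → ℝ → ℝ) (i : ℤ) : ℝ :=
  derivWithin (f i) (Icc 0 1) 0

/-- The conditions of KPP type on one realization of the reaction terms `f(i, s)`, `0 ≤ s ≤ 1`,
and of the diffusion rates `d_i` (the rate from `i` to `i + 1` being `d_{i+1}`). -/
structure IsKPPRealization (α : ℝ) (f : ℤ → ℝ → ℝ) (d : ℤ → ℝ) : Prop where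
  inf_d_pos : ∃ m : ℝ, 0 < m ∧ ∀ i, m ≤ d i
  sup_d_finite : ∃ M : ℝ, ∀ i, d i ≤ M
  contDiff : ∀ i, ContDiffOn ℝ 1 (f i) (Icc 0 1)
  /-- The norms of `f(i, ·)` in `C^{1+α}([0, 1])` are bounded uniformly in `i`. -/
  holder : ∃ K : ℝ, ∀ i, ∀ s ∈ Icc (0 : ℝ) 1,
    |f i s| ≤ K ∧ |derivWithin (f i) (Icc 0 1) s| ≤ K ∧
    ∀ t ∈ Icc (0 : ℝ) 1,
      |derivWithin (f i) (Icc 0 1) s - derivWithin (f i) (Icc 0 1) t| ≤ K * |s - t| ^ α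
  map_zero : ∀ i, f i 0 = 0
  map_one : ∀ i, f i 1 = 0
  inf_f_pos : ∀ s ∈ Ioo (0 : ℝ) 1, ∃ m : ℝ, 0 < m ∧ ∀ i, m ≤ f i s
  kpp : ∀ i, ∀ s ∈ Ioo (0 : ℝ) 1, f i s ≤ growthRate f i * s
  /-- `liminf_{|i| → ∞} (c_i - (√d_{i+1} - √d_i)²) > 0`. -/
  liminf_pos : ∃ ε : ℝ, 0 < ε ∧
    ∀ᶠ i : ℤ in cofinite, ε ≤ growthRate f i - (√(d (i + 1)) - √(d i)) ^ 2

/-- `Γ` is the constant to which, almost surely, the principal eigenvalues on the growing boxes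
`{-k+1, …, k}`, `{-k+1, …, 0}` and `{1, …, k}` all converge as `k → ∞`. -/
def IsLimitPrincipalEigenvalue {Ω : Type*} [MeasurableSpace Ω] (P : Measure Ω)
    (d c : ℤ → Ω → ℝ) (Γ : ℝ) : Prop :=
  ∀ᵐ ω ∂P,
    Tendsto (fun k : ℕ => principalEigenvalue (d · ω) (c · ω) (-(k : ℤ)) (2 * k)) atTop (𝓝 Γ) ∧
    Tendsto (fun k : ℕ => principalEigenvalue (d · ω) (c · ω) (-(k : ℤ)) k) atTop (𝓝 Γ) ∧
    Tendsto (fun k : ℕ => principalEigenvalue (d · ω) (c · ω) 0 k) atTop (𝓝 Γ)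

/-! The operator is a Jacobi operator, and a level t lies above the principal eigenvalue of a box
exactly when the solution starting from zero at the left end stays positive up to and including the
right boundary node (Sturm oscillation). Positivity survives raising t and shrinking the box. By
ergodicity each level is thus almost surely either good on all boxes, or bad on some box to the
right of 0 and on some box to its left; the infimum of the good levels is Γ.

Above Γ, the backward Riccati iterates increase to the ratios r_i = u_i / u_{i-1} of the positive
solution minimal at +∞. The key tool is `minRatio_le`: r lies below the ratios of every positive
supersolution. Comparison with other levels, weighted geometric means and constants shows that r
decreases in t, that log r is convex in t, and that r is small for large t. Lagrange's identity
against a level strictly between Γ and t makes u square summable at +∞, hence decaying; constancy of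
the Wronskian gives uniqueness.

The ratios are covariant under shifts, so -log u is a Birkhoff sum over the shift to the right and
over its inverse to the left. The pointwise ergodic theorem, proved here by a maximal function
argument, gives both ends the same rate μ(t) = E[-log r_0]. Strict monotonicity, concavity and
divergence pass from -log r_0 to its mean. Concavity makes μ continuous, so rational levels suffice
to find one null set for all levels. -/

/-! ### Dirichlet solutions on boxes and principal eigenvalues. -/

/-- The coefficient of `φ_i` in `(t - L) φ`. -/
def diagCoeff (d c : ℤ → ℝ) (t : ℝ) (i : ℤ) : ℝ := t - c i + d (i + 1) + d i

/-- The solution of `(L - t) φ = 0` to the right of `l`, with `φ_l = 0` and `φ_{l+1} = 1`,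
as a function of the distance to `l`. -/
noncomputable def dirichletSol (d c : ℤ → ℝ) (t : ℝ) (l : ℤ) : ℕ → ℝ
  | 0 => 0
  | 1 => 1
  | n + 2 => (diagCoeff d c t (l + n + 1) * dirichletSol d c t l (n + 1)
      - d (l + n + 1) * dirichletSol d c t l n) / d (l + n + 2)

/-- The Dirichlet solution starting at `l` is positive on `{l+1, …, l+k+1}`. -/
def PosBox (d c : ℤ → ℝ) (t : ℝ) (l : ℤ) (k : ℕ) : Prop :=
  ∀ j ≤ k, 0 < dirichletSol d c t l (j + 1)

theorem latticeOp_sub_eq (d c φ : ℤ → ℝ) (t : ℝ) (i : ℤ) :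
    latticeOp d c φ i - t * φ i
      = d (i + 1) * φ (i + 1) + d i * φ (i - 1) - diagCoeff d c t i * φ i := by
  simp only [latticeOp, diagCoeff]; ring

section Deterministic

variable {d c : ℤ → ℝ}

theorem dirichletSol_rec (hd : ∀ i, 0 < d i) (t : ℝ) (l : ℤ) (n : ℕ) :
    d (l + n + 2) * dirichletSol d c t l (n + 2)
      = diagCoeff d c t (l + n + 1) * dirichletSol d c t l (n + 1)
        - d (l + n + 1) * dirichletSol d c t l n := by
  rw [dirichletSol]
  field_simp [(hd (l + n + 2)).ne']

/-- A positive supersolution on a box forces the Dirichlet solution to be positive there. -/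
theorem posBox_of_supersolution (hd : ∀ i, 0 < d i) {t : ℝ} {l : ℤ} {k : ℕ} {s : ℕ → ℝ}
    (h0 : 0 ≤ s 0) (hpos : ∀ j ≤ k, 0 < s (j + 1))
    (hs : ∀ n, n + 1 ≤ k → d (l + n + 2) * s (n + 2)
      ≤ diagCoeff d c t (l + n + 1) * s (n + 1) - d (l + n + 1) * s n) :
    PosBox d c t l k := by
  -- The first quantity being nonnegative says that the quotient of the Dirichlet solution by `s`
  -- does not decrease.
  have key : ∀ n ≤ k, 0 ≤ dirichletSol d c t l (n + 1) * s n - dirichletSol d c t l n * s (n + 1) ∧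
      0 < dirichletSol d c t l (n + 1) := by
    intro n
    induction n with
    | zero => intro _; simp [dirichletSol, h0]
    | succ n ih =>
      intro hn
      obtain ⟨hW, hp⟩ := ih (by omega)
      have h1 := hs n hn
      have h2 := dirichletSol_rec (c := c) hd t l n
      have hd1 := hd (l + n + 1)
      have hd2 := hd (l + n + 2)
      have hs1 := hpos n (by omega)
      have hs2 := hpos (n + 1) hn
      have hW' : 0 ≤ dirichletSol d c t l (n + 1 + 1) * s (n + 1)
          - dirichletSol d c t l (n + 1) * s (n + 1 + 1) := by
        have : 0 ≤ d (l + n + 2) * (dirichletSol d c t l (n + 2) * s (n + 1)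
          - dirichletSol d c t l (n + 1) * s (n + 2)) := by
          have e1 : d (l + n + 2) * (dirichletSol d c t l (n + 2) * s (n + 1)
            - dirichletSol d c t l (n + 1) * s (n + 2))
            = (d (l + n + 2) * dirichletSol d c t l (n + 2)) * s (n + 1)
              - dirichletSol d c t l (n + 1) * (d (l + n + 2) * s (n + 2)) := by ring
          rw [e1, h2]
          have e2 := mul_le_mul_of_nonneg_left h1 hp.le
          have e3 := mul_nonneg hd1.le hW
          nlinarith
        exact nonneg_of_mul_nonneg_right this hd2
      refine ⟨hW', ?_⟩
      have : 0 < dirichletSol d c t l (n + 1 + 1) * s (n + 1) := by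
        have := mul_pos hp hs2
        linarith
      exact pos_of_mul_pos_left this hs1.le
  exact fun j hj => (key j hj).2

theorem PosBox.mono (hd : ∀ i, 0 < d i) {t t' : ℝ} (h : t ≤ t') {l : ℤ} {k : ℕ}
    (hP : PosBox d c t l k) : PosBox d c t' l k := by
  refine posBox_of_supersolution hd (s := dirichletSol d c t l) (by simp [dirichletSol]) hP
    fun n hn => ?_
  rw [dirichletSol_rec hd]
  have := mul_le_mul_of_nonneg_right h (hP n (by omega)).le
  simp only [diagCoeff]
  nlinarith

theorem PosBox.mono_right {t : ℝ} {l : ℤ} {k k' : ℕ} (h : k' ≤ k)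
    (hP : PosBox d c t l k) : PosBox d c t l k' :=
  fun j hj => hP j (hj.trans h)

/-- The solution started at `l` is itself a supersolution on the shorter box: it solves the equation
there and is positive at `l + 1`. -/
theorem PosBox.tail (hd : ∀ i, 0 < d i) {t : ℝ} {l : ℤ} {k : ℕ}
    (hP : PosBox d c t l (k + 1)) : PosBox d c t (l + 1) k := by
  refine posBox_of_supersolution hd (s := fun n => dirichletSol d c t l (n + 1))
    (hP 0 (by omega)).le (fun j hj => hP (j + 1) (by omega)) fun n hn => ?_
  have := dirichletSol_rec (c := c) hd t l (n + 1)
  push_cast at this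
  rw [show l + 1 + (n : ℤ) + 2 = l + (n + 1) + 2 by ring,
    show l + 1 + (n : ℤ) + 1 = l + (n + 1) + 1 by ring]
  exact this.le

theorem PosBox.drop (hd : ∀ i, 0 < d i) {t : ℝ} {l : ℤ} {k : ℕ} (m : ℕ)
    (hP : PosBox d c t l (k + m)) : PosBox d c t (l + m) k := by
  induction m generalizing l with
  | zero => simpa using hP
  | succ m ih =>
    have := ih (l := l + 1) (PosBox.tail hd hP)
    rwa [show l + 1 + (m : ℤ) = l + ((m + 1 : ℕ) : ℤ) by push_cast; ring] at this

theorem posBox_of_ge (hd : ∀ i, 0 < d i) {t : ℝ} (ht : ∀ i, c i ≤ t) (l : ℤ) (k : ℕ) :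
    PosBox d c t l k := by
  refine posBox_of_supersolution hd (s := fun _ => 1) zero_le_one (fun _ _ => one_pos)
    fun n _ => ?_
  have := ht (l + n + 1)
  simp only [diagCoeff, show l + (n : ℤ) + 1 + 1 = l + n + 2 by ring]
  linarith

theorem PosBox.diagCoeff_pos (hd : ∀ i, 0 < d i) {t : ℝ} {l : ℤ} {k : ℕ} (hk : 1 ≤ k)
    (h : PosBox d c t l k) : 0 < diagCoeff d c t (l + 1) := by
  have h1 := h 1 hk
  have h2 := dirichletSol_rec (c := c) hd t l 0
  simp only [dirichletSol, Nat.cast_zero, add_zero, mul_one, mul_zero, sub_zero] at h1 h2 ⊢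
  exact (div_pos_iff_of_pos_right (hd _)).1 h1

theorem continuous_dirichletSol (d c : ℤ → ℝ) (l : ℤ) (n : ℕ) :
    Continuous fun t => dirichletSol d c t l n := by
  induction n using Nat.twoStepInduction with
  | zero => simpa [dirichletSol] using continuous_const
  | one => simpa [dirichletSol] using continuous_const
  | more n h1 h2 =>
    simp only [dirichletSol, diagCoeff]
    fun_prop

/-- The recursion determines a solution vanishing at `l` up to its value at `l + 1`, so every
eigenfunction is a multiple of the Dirichlet solution. -/
theorem isDirichletEigenvalue_iff (hd : ∀ i, 0 < d i) {t : ℝ} {l : ℤ} {k : ℕ} (hk : 1 ≤ k) :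
    IsDirichletEigenvalue d c l k t ↔ dirichletSol d c t l (k + 1) = 0 := by
  constructor
  · rintro ⟨φ, h0, h1, ⟨i, hi, hne⟩, heq⟩
    have key : ∀ n ≤ k + 1, φ (l + n) = φ (l + 1) * dirichletSol d c t l n := by
      intro n
      induction n using Nat.twoStepInduction with
      | zero => intro _; simp [dirichletSol, h0]
      | one => intro _; simp [dirichletSol]
      | more n ih1 ih2 =>
        intro hn
        have e1 := ih1 (by omega)
        have e2 := ih2 (by omega)
        have e3 := heq (l + n + 1) ⟨by omega, by omega⟩
        have e4 := latticeOp_sub_eq d c φ t (l + n + 1)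
        have e5 := dirichletSol_rec (c := c) hd t l n
        push_cast at e2 ⊢
        rw [show l + (n : ℤ) + 1 + 1 = l + (n + 2) by ring,
          show l + (n : ℤ) + 1 - 1 = l + n by ring, e3, sub_self] at e4
        rw [show l + (n : ℤ) + 1 = l + (n + 1) by ring, show l + (n : ℤ) + 2 = l + (n + 2) by ring]
          at e5
        rw [show l + (n : ℤ) + 1 = l + (n + 1) by ring] at e4
        rw [e1, e2] at e4
        have := (hd (l + (n + 2))).ne'
        apply mul_left_cancel₀ this
        linear_combination (-1 : ℝ) * e4 - φ (l + 1) * e5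
    have hφ : φ (l + 1) ≠ 0 := by
      intro h
      obtain ⟨n, rfl⟩ : ∃ n : ℕ, i = l + n := ⟨(i - l).toNat, by have := hi.1; omega⟩
      apply hne
      rw [key n (by have := hi.2; omega), h, zero_mul]
    have := key (k + 1) le_rfl
    push_cast at this
    rw [← add_assoc, h1] at this
    simpa [hφ] using this.symm
  · intro h
    refine ⟨fun i => dirichletSol d c t l (i - l).toNat, by simp [dirichletSol], ?_, ⟨l + 1, ?_, ?_⟩,
      ?_⟩
    · simp only [show (l + (k : ℤ) + 1 - l).toNat = k + 1 by omega, h]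
    · exact ⟨le_rfl, by omega⟩
    · simp [dirichletSol]
    · rintro i ⟨hi1, hi2⟩
      obtain ⟨n, rfl⟩ : ∃ n : ℕ, i = l + n + 1 := ⟨(i - l - 1).toNat, by omega⟩
      rw [← sub_eq_zero, latticeOp_sub_eq]
      have e5 := dirichletSol_rec (c := c) hd t l n
      simp only [show (l + (n : ℤ) + 2 - l).toNat = n + 2 by omega,
        show (l + (n : ℤ) + 1 - 1 - l).toNat = n by omega,
        show (l + (n : ℤ) + 1 - l).toNat = n + 1 by omega,
        show l + (n : ℤ) + 1 + 1 = l + n + 2 by ring]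
      linarith

/-- The principal eigenvalue of a box lies below `t` exactly when the Dirichlet solution at
level `t` stays positive on the box. -/
theorem principalEigenvalue_lt_iff (hd : ∀ i, 0 < d i) {K : ℝ} (hc : ∀ i, c i ≤ K)
    {t : ℝ} {l : ℤ} {k : ℕ} (hk : 1 ≤ k) :
    principalEigenvalue d c l k < t ↔ PosBox d c t l k := by
  -- The good levels form a nonempty, open, upward closed set bounded below, hence an open
  -- half-line; its endpoint is shown to be the largest eigenvalue.
  set Q : Set ℝ := {t | PosBox d c t l k} with hQ
  have hne : Q.Nonempty := ⟨K, posBox_of_ge hd hc l k⟩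
  have hbdd : BddBelow Q := by
    refine ⟨c (l + 1) - d (l + 1 + 1) - d (l + 1), fun x hx => ?_⟩
    have := PosBox.diagCoeff_pos hd hk hx
    simp only [diagCoeff] at this
    linarith
  have hopen : IsOpen Q := by
    have : Q = ⋂ j ∈ Iic k, {t | 0 < dirichletSol d c t l (j + 1)} := by
      ext t; simp [hQ, PosBox]
    rw [this]
    exact (finite_Iic k).isOpen_biInter fun j _ =>
      isOpen_lt continuous_const (continuous_dirichletSol d c l (j + 1))
  set τ := sInf Q with hτ
  have hτQ : τ ∉ Q := by
    intro h
    obtain ⟨ε, hε, hb⟩ := Metric.isOpen_iff.1 hopen τ h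
    have : τ - ε / 2 ∈ Q := hb (by simp [abs_of_pos hε, hε])
    have := csInf_le hbdd this
    linarith
  have hmem : ∀ x, x ∈ Q ↔ τ < x := by
    intro x
    constructor
    · intro hx
      exact lt_of_le_of_ne (csInf_le hbdd hx) (fun h => hτQ (h ▸ hx))
    · intro hx
      obtain ⟨y, hy, hyx⟩ := exists_lt_of_csInf_lt hne hx
      exact PosBox.mono hd hyx.le hy
  have hnonneg : ∀ j ≤ k, 0 ≤ dirichletSol d c τ l (j + 1) := by
    intro j hj
    have hcl : τ ∈ closure Q := csInf_mem_closure hne hbdd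
    exact closure_minimal (fun x hx => (hx j hj).le)
      (isClosed_le continuous_const (continuous_dirichletSol d c l (j + 1))) hcl
  -- At the endpoint the values are nonnegative by continuity. A zero after a positive value would
  -- make the next value negative, so the only possible zero is at the right boundary node.
  have hpos : ∀ j < k, 0 < dirichletSol d c τ l (j + 1) := by
    intro j
    induction j with
    | zero => intro _; simp [dirichletSol]
    | succ j ih =>
      intro hj
      have h1 := ih (by omega)
      refine lt_of_le_of_ne (hnonneg (j + 1) hj.le) fun h => ?_
      have h2 := hnonneg (j + 2) hj
      have h3 := dirichletSol_rec (c := c) hd τ l (j + 1)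
      rw [← h] at h3
      have h4 := mul_pos (hd (l + (j + 1 : ℕ) + 1)) h1
      have h5 := mul_nonneg (hd (l + (j + 1 : ℕ) + 2)).le h2
      rw [h3] at h5
      linarith
  have hzero : dirichletSol d c τ l (k + 1) = 0 := by
    by_contra h
    apply hτQ
    intro j hj
    rcases hj.lt_or_eq with hj | rfl
    · exact hpos j hj
    · exact lt_of_le_of_ne (hnonneg j le_rfl) (Ne.symm h)
  have hgr : IsGreatest {ev | IsDirichletEigenvalue d c l k ev} τ := by
    refine ⟨(isDirichletEigenvalue_iff hd hk).2 hzero, fun ev hev => ?_⟩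
    have hev' := (isDirichletEigenvalue_iff hd hk).1 hev
    by_contra! hlt
    exact ((hmem ev).2 hlt k le_rfl).ne' hev'
  rw [principalEigenvalue, hgr.csSup_eq]
  exact (hmem t).symm

end Deterministic

/-! ### Riccati iterates and the solution minimal at +∞. -/

/-- All Dirichlet solutions at level `t` are positive: `t` lies above all principal
eigenvalues. -/
def AllPos (d c : ℤ → ℝ) (t : ℝ) : Prop := ∀ l k, PosBox d c t l k

/-- The backward Riccati iterates: `riccati n i` is the ratio `φ_i / φ_{i-1}` for the solution of
`(L - t) φ = 0` with `φ_{i+n} = 0`. -/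
noncomputable def riccati (d c : ℤ → ℝ) (t : ℝ) : ℕ → ℤ → ℝ
  | 0, _ => 0
  | n + 1, i => d i / (diagCoeff d c t i - d (i + 1) * riccati d c t n (i + 1))

/-- The ratio `u_i / u_{i-1}` of the solution `u` which is minimal at `+∞`. -/
noncomputable def minRatio (d c : ℤ → ℝ) (t : ℝ) (i : ℤ) : ℝ := ⨆ n, riccati d c t n i

/-- The function on `ℤ` which vanishes at `0` and has increments `g i` from `i - 1` to `i`. -/
noncomputable def signedSum (g : ℤ → ℝ) : ℤ → ℝ
  | Int.ofNat n => ∑ k ∈ Finset.range n, g (k + 1)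
  | Int.negSucc n => -∑ k ∈ Finset.range (n + 1), g (-k)

theorem signedSum_natCast (g : ℤ → ℝ) (n : ℕ) :
    signedSum g n = ∑ k ∈ Finset.range n, g (k + 1) := rfl

theorem signedSum_zero (g : ℤ → ℝ) : signedSum g 0 = 0 := by
  simpa using signedSum_natCast g 0

theorem signedSum_neg_natCast (g : ℤ → ℝ) (n : ℕ) :
    signedSum g (-n) = -∑ k ∈ Finset.range n, g (-k) := by
  cases n with
  | zero => simp [signedSum_zero]
  | succ n => rfl

theorem signedSum_eq_add (g : ℤ → ℝ) (i : ℤ) : signedSum g i = signedSum g (i - 1) + g i := by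
  obtain ⟨n, rfl | rfl⟩ := i.eq_nat_or_neg
  · cases n with
    | zero =>
      have := signedSum_neg_natCast g 1
      simp only [Nat.cast_one, Finset.range_one, Finset.sum_singleton, Nat.cast_zero,
        neg_zero] at this
      rw [Nat.cast_zero, signedSum_zero, zero_sub, this, neg_add_cancel]
    | succ n =>
      rw [show (((n + 1 : ℕ) : ℤ) - 1) = (n : ℤ) by push_cast; ring, signedSum_natCast,
        signedSum_natCast, Finset.sum_range_succ]
      push_cast; ring
  · rw [show (-(n : ℤ) - 1) = -((n + 1 : ℕ) : ℤ) by push_cast; ring, signedSum_neg_natCast,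
      signedSum_neg_natCast, Finset.sum_range_succ]
    ring

/-- The function with value `1` at `0` and with ratios `r i` from `i - 1` to `i`. -/
noncomputable def ratioProd (r : ℤ → ℝ) (i : ℤ) : ℝ :=
  Real.exp (signedSum (fun j => Real.log (r j)) i)

theorem ratioProd_pos (r : ℤ → ℝ) (i : ℤ) : 0 < ratioProd r i := Real.exp_pos _

theorem ratioProd_zero (r : ℤ → ℝ) : ratioProd r 0 = 1 := by
  rw [ratioProd, signedSum_zero, Real.exp_zero]

theorem log_ratioProd (r : ℤ → ℝ) (i : ℤ) :
    Real.log (ratioProd r i) = signedSum (fun j => Real.log (r j)) i := Real.log_exp _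

theorem ratioProd_add_one {r : ℤ → ℝ} (hr : ∀ i, 0 < r i) (i : ℤ) :
    ratioProd r (i + 1) = ratioProd r i * r (i + 1) := by
  rw [ratioProd, signedSum_eq_add, Real.exp_add, Real.exp_log (hr _), add_sub_cancel_right,
    ratioProd]

theorem signedSum_le_of_nonneg {g h : ℤ → ℝ} (hgh : ∀ i, g i ≤ h i) (n : ℕ) :
    signedSum g n ≤ signedSum h n := by
  simp only [signedSum_natCast]
  exact Finset.sum_le_sum fun k _ => hgh _

theorem signedSum_neg_ge {g h : ℤ → ℝ} (hgh : ∀ i, g i ≤ h i) (n : ℕ) :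
    signedSum h (-n) ≤ signedSum g (-n) := by
  simp only [signedSum_neg_natCast]
  exact neg_le_neg (Finset.sum_le_sum fun k _ => hgh _)

theorem dirichletSol_shift (d c : ℤ → ℝ) (t : ℝ) (j l : ℤ) (n : ℕ) :
    dirichletSol (fun i => d (i + j)) (fun i => c (i + j)) t l n = dirichletSol d c t (l + j) n := by
  induction n using Nat.twoStepInduction with
  | zero => rfl
  | one => rfl
  | more n h1 h2 =>
    simp only [dirichletSol, diagCoeff, h1, h2]
    simp only [show l + (n : ℤ) + 1 + j = l + j + n + 1 by ring,
      show l + (n : ℤ) + 1 + 1 + j = l + j + n + 1 + 1 by ring,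
      show l + (n : ℤ) + 2 + j = l + j + n + 2 by ring]

theorem riccati_shift (d c : ℤ → ℝ) (t : ℝ) (j : ℤ) (n : ℕ) (i : ℤ) :
    riccati (fun i => d (i + j)) (fun i => c (i + j)) t n i = riccati d c t n (i + j) := by
  induction n generalizing i with
  | zero => rfl
  | succ n ih =>
    simp only [riccati, diagCoeff, ih]
    simp only [show i + 1 + j = i + j + 1 by ring]

theorem minRatio_shift (d c : ℤ → ℝ) (t : ℝ) (j i : ℤ) :
    minRatio (fun i => d (i + j)) (fun i => c (i + j)) t i = minRatio d c t (i + j) := by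
  simp only [minRatio, riccati_shift]

section Deterministic

variable {d c : ℤ → ℝ}

theorem AllPos.mono (hd : ∀ i, 0 < d i) {t t' : ℝ} (h : t ≤ t') (hP : AllPos d c t) :
    AllPos d c t' := fun l k => (hP l k).mono hd h

theorem AllPos.diagCoeff_pos (hd : ∀ i, 0 < d i) {t : ℝ} (hP : AllPos d c t) (i : ℤ) :
    0 < diagCoeff d c t i := by
  have := PosBox.diagCoeff_pos hd le_rfl (hP (i - 1) 1)
  rwa [sub_add_cancel] at this

/-- Staying below a supersolution ratio keeps every denominator positive. Iterates at `j` look only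
to the right, so a supersolution on a half-line is enough. -/
theorem riccati_lt (hd : ∀ i, 0 < d i) {t : ℝ} {i : ℤ} {s : ℤ → ℝ} (hs : ∀ j ≥ i, 0 < s j)
    (hr : ∀ j ≥ i, d (j + 1) * s (j + 1) + d j / s j ≤ diagCoeff d c t j) (n : ℕ) :
    ∀ j ≥ i, 0 ≤ riccati d c t n j ∧ riccati d c t n j < s j ∧
      0 < diagCoeff d c t j - d (j + 1) * riccati d c t n (j + 1) := by
  have key : ∀ j ≥ i, ∀ x < s (j + 1), d j / s j < diagCoeff d c t j - d (j + 1) * x := by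
    intro j hj x hx
    have := mul_lt_mul_of_pos_left hx (hd (j + 1))
    have := hr j hj
    linarith
  have key2 : ∀ j ≥ i, 0 < d j / s j := fun j hj => div_pos (hd j) (hs j hj)
  induction n with
  | zero =>
    exact fun j hj => ⟨le_rfl, hs j hj, (key2 j hj).trans (key j hj _ (hs (j + 1) (by omega)))⟩
  | succ n ih =>
    have main : ∀ j ≥ i, 0 ≤ riccati d c t (n + 1) j ∧ riccati d c t (n + 1) j < s j := by
      intro j hj
      have h1 := (ih j hj).2.2
      have h2 := key j hj _ (ih (j + 1) (by omega)).2.1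
      refine ⟨div_nonneg (hd j).le h1.le, ?_⟩
      rw [riccati, div_lt_iff₀ h1]
      rw [div_lt_iff₀ (hs j hj)] at h2
      linarith
    exact fun j hj => ⟨(main j hj).1, (main j hj).2,
      (key2 j hj).trans (key j hj _ (main (j + 1) (by omega)).2)⟩

theorem riccati_le_succ (hd : ∀ i, 0 < d i) {t : ℝ} {i : ℤ} {s : ℤ → ℝ} (hs : ∀ j ≥ i, 0 < s j)
    (hr : ∀ j ≥ i, d (j + 1) * s (j + 1) + d j / s j ≤ diagCoeff d c t j) (n : ℕ) :
    ∀ j ≥ i, riccati d c t n j ≤ riccati d c t (n + 1) j := by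
  induction n with
  | zero => exact fun j hj => (riccati_lt hd hs hr 1 j hj).1
  | succ n ih =>
    intro j hj
    rw [riccati, riccati]
    have h1 := (riccati_lt hd hs hr (n + 1) j hj).2.2
    have h2 := ih (j + 1) (by omega)
    have := hd (j + 1)
    have := (hd j).le
    gcongr

/-- The Dirichlet solution started at `i - 2` is positive from `i - 1` on, so its ratios φ_j /
φ_{j-1} are defined and positive for all `j ≥ i`. -/
theorem AllPos.exists_ratio (hd : ∀ i, 0 < d i) {t : ℝ} (hP : AllPos d c t) (i : ℤ) :
    ∃ s : ℤ → ℝ, (∀ j ≥ i, 0 < s j) ∧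
      ∀ j ≥ i, d (j + 1) * s (j + 1) + d j / s j ≤ diagCoeff d c t j := by
  have hp : ∀ n, 0 < dirichletSol d c t (i - 2) (n + 1) := fun n => hP (i - 2) n n le_rfl
  refine ⟨fun j => dirichletSol d c t (i - 2) ((j - i).toNat + 2)
    / dirichletSol d c t (i - 2) ((j - i).toNat + 1), fun j _ => div_pos (hp _) (hp _), ?_⟩
  intro j hj
  obtain ⟨n, rfl⟩ : ∃ n : ℕ, j = i + n := ⟨(j - i).toNat, by omega⟩
  have h := dirichletSol_rec (c := c) hd t (i - 2) (n + 1)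
  simp only [show (i + (n : ℤ) - i).toNat = n by omega,
    show (i + (n : ℤ) + 1 - i).toNat = n + 1 by omega]
  rw [show i - 2 + ((n + 1 : ℕ) : ℤ) + 2 = i + n + 1 by push_cast; ring,
    show i - 2 + ((n + 1 : ℕ) : ℤ) + 1 = i + n by push_cast; ring] at h
  have h1 := hp n
  have h2 := hp (n + 1)
  have e : d (i + n + 1) * (dirichletSol d c t (i - 2) (n + 1 + 2)
      / dirichletSol d c t (i - 2) (n + 1 + 1)) + d (i + n) / (dirichletSol d c t (i - 2) (n + 2)
      / dirichletSol d c t (i - 2) (n + 1)) = diagCoeff d c t (i + n) := by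
    rw [← mul_div_assoc, h]
    field_simp
    ring
  exact e.le

theorem minRatio_le (hd : ∀ i, 0 < d i) {t : ℝ} {i : ℤ} {s : ℤ → ℝ} (hs : ∀ j ≥ i, 0 < s j)
    (hr : ∀ j ≥ i, d (j + 1) * s (j + 1) + d j / s j ≤ diagCoeff d c t j) :
    minRatio d c t i ≤ s i :=
  ciSup_le fun n => (riccati_lt hd hs hr n i le_rfl).2.1.le

theorem AllPos.monotone_riccati (hd : ∀ i, 0 < d i) {t : ℝ} (hP : AllPos d c t) (i : ℤ) :
    Monotone fun n => riccati d c t n i := by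
  obtain ⟨s, hs, hr⟩ := hP.exists_ratio hd i
  exact monotone_nat_of_le_succ fun n => riccati_le_succ hd hs hr n i le_rfl

theorem AllPos.bddAbove_riccati (hd : ∀ i, 0 < d i) {t : ℝ} (hP : AllPos d c t) (i : ℤ) :
    BddAbove (range fun n => riccati d c t n i) := by
  obtain ⟨s, hs, hr⟩ := hP.exists_ratio hd i
  refine ⟨s i, ?_⟩
  rintro _ ⟨n, rfl⟩
  exact (riccati_lt hd hs hr n i le_rfl).2.1.le

theorem AllPos.tendsto_riccati (hd : ∀ i, 0 < d i) {t : ℝ} (hP : AllPos d c t) (i : ℤ) :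
    Tendsto (fun n => riccati d c t n i) atTop (𝓝 (minRatio d c t i)) :=
  tendsto_atTop_ciSup (hP.monotone_riccati hd i) (hP.bddAbove_riccati hd i)

theorem AllPos.minRatio_pos (hd : ∀ i, 0 < d i) {t : ℝ} (hP : AllPos d c t) (i : ℤ) :
    0 < minRatio d c t i := by
  have h1 : riccati d c t 1 i ≤ minRatio d c t i := le_ciSup (hP.bddAbove_riccati hd i) 1
  have h2 : 0 < riccati d c t 1 i := by
    simp only [riccati, mul_zero, sub_zero]
    exact div_pos (hd i) (hP.diagCoeff_pos hd i)
  exact h2.trans_le h1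

theorem AllPos.minRatio_eq (hd : ∀ i, 0 < d i) {t : ℝ} (hP : AllPos d c t) (i : ℤ) :
    d (i + 1) * minRatio d c t (i + 1) + d i / minRatio d c t i = diagCoeff d c t i := by
  obtain ⟨s, hs, hr⟩ := hP.exists_ratio hd i
  -- The recursion is multiplied out so that the limit can be taken before the limiting denominator
  -- is known to be nonzero.
  have h1 : ∀ n, riccati d c t (n + 1) i
      * (diagCoeff d c t i - d (i + 1) * riccati d c t n (i + 1)) = d i := fun n => by
    rw [riccati]
    exact div_mul_cancel₀ _ (riccati_lt hd hs hr n i le_rfl).2.2.ne'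
  have h2 := ((tendsto_add_atTop_iff_nat 1).2 (hP.tendsto_riccati hd i)).mul
    (((hP.tendsto_riccati hd (i + 1)).const_mul (d (i + 1))).const_sub (diagCoeff d c t i))
  simp only [h1] at h2
  have h3 := tendsto_nhds_unique tendsto_const_nhds h2
  have h4 := (hP.minRatio_pos hd i).ne'
  field_simp
  linarith

theorem AllPos.minRatio_anti (hd : ∀ i, 0 < d i) {t t' : ℝ} (h : t ≤ t') (hP : AllPos d c t)
    (i : ℤ) : minRatio d c t' i ≤ minRatio d c t i := by
  refine minRatio_le hd (fun j _ => hP.minRatio_pos hd j) fun j _ => ?_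
  rw [hP.minRatio_eq hd]
  simp only [diagCoeff]
  linarith

/-- In the Riccati equation a higher level raises the right side strictly and does not raise
r_{i+1}, so d_i / r_i must grow strictly. -/
theorem AllPos.minRatio_lt (hd : ∀ i, 0 < d i) {t t' : ℝ} (h : t < t') (hP : AllPos d c t)
    (i : ℤ) : minRatio d c t' i < minRatio d c t i := by
  have hP' := hP.mono hd h.le
  have h1 := hP.minRatio_eq hd i
  have h2 := hP'.minRatio_eq hd i
  have h3 := mul_le_mul_of_nonneg_left (hP.minRatio_anti hd h.le (i + 1)) (hd (i + 1)).le
  have h4 : d i / minRatio d c t i < d i / minRatio d c t' i := by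
    simp only [diagCoeff] at h1 h2
    linarith
  exact (div_lt_div_iff_of_pos_left (hd i) (hP.minRatio_pos hd i) (hP'.minRatio_pos hd i)).1 h4

/-- The weighted geometric mean of two solution ratios is a supersolution ratio at the averaged
level: the AM-GM inequality applies to the ratios and to their inverses, and the diagonal
coefficient is affine in t. -/
theorem minRatio_convex (hd : ∀ i, 0 < d i) {t₁ t₂ a b : ℝ} (h₁ : AllPos d c t₁)
    (h₂ : AllPos d c t₂) (ha : 0 ≤ a) (hb : 0 ≤ b) (hab : a + b = 1) (i : ℤ) :
    minRatio d c (a * t₁ + b * t₂) i ≤ minRatio d c t₁ i ^ a * minRatio d c t₂ i ^ b := by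
  have p₁ := h₁.minRatio_pos hd
  have p₂ := h₂.minRatio_pos hd
  refine minRatio_le hd (s := fun i => minRatio d c t₁ i ^ a * minRatio d c t₂ i ^ b)
    (fun j _ => mul_pos (Real.rpow_pos_of_pos (p₁ j) a) (Real.rpow_pos_of_pos (p₂ j) b))
    fun j _ => ?_
  have e₁ := h₁.minRatio_eq hd j
  have e₂ := h₂.minRatio_eq hd j
  have g₁ := Real.geom_mean_le_arith_mean2_weighted ha hb (p₁ (j + 1)).le (p₂ (j + 1)).le hab
  have g₂ := Real.geom_mean_le_arith_mean2_weighted ha hb (inv_pos.2 (p₁ j)).le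
    (inv_pos.2 (p₂ j)).le hab
  rw [Real.inv_rpow (p₁ j).le, Real.inv_rpow (p₂ j).le, ← mul_inv] at g₂
  have g₁' := mul_le_mul_of_nonneg_left g₁ (hd (j + 1)).le
  have g₂' := mul_le_mul_of_nonneg_left g₂ (hd j).le
  rw [div_eq_mul_inv] at e₁ e₂ ⊢
  refine (add_le_add g₁' g₂').trans (le_of_eq ?_)
  simp only [diagCoeff] at e₁ e₂ ⊢
  obtain rfl : b = 1 - a := by linarith
  linear_combination a * e₁ + (1 - a) * e₂

/-- Constants are supersolutions here, so r_{i+1} ≤ 1; the Riccati equation then bounds d_i / r_i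
from below. -/
theorem minRatio_le_div (hd : ∀ i, 0 < d i) {t : ℝ} (ht : ∀ i, c i < t) (i : ℤ) :
    minRatio d c t i ≤ d i / (t - c i) := by
  have hP : AllPos d c t := posBox_of_ge hd fun i => (ht i).le
  have h1 : minRatio d c t (i + 1) ≤ 1 := by
    refine minRatio_le hd (s := fun _ => 1) (fun _ _ => one_pos) fun j _ => ?_
    have := ht j
    simp only [diagCoeff, mul_one, div_one]
    linarith
  have h2 := hP.minRatio_eq hd i
  have h3 := mul_le_mul_of_nonneg_left h1 (hd (i + 1)).le
  have h4 := hP.minRatio_pos hd i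
  rw [le_div_iff₀ (by linarith [ht i]), mul_comm, ← le_div_iff₀ h4]
  simp only [diagCoeff] at h2
  linarith [hd i]

theorem AllPos.minRatio_bounds (hd : ∀ i, 0 < d i) {t m B : ℝ} (hm : 0 < m) (hmd : ∀ i, m ≤ d i)
    (hB : ∀ i, diagCoeff d c t i ≤ B) (hP : AllPos d c t) (i : ℤ) :
    m / B ≤ minRatio d c t i ∧ minRatio d c t i ≤ B / m := by
  have hB0 : 0 < B := (hP.diagCoeff_pos hd i).trans_le (hB i)
  have p := hP.minRatio_pos hd
  constructor
  · have h := hP.minRatio_eq hd i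
    have h1 := mul_pos (hd (i + 1)) (p (i + 1))
    rw [div_le_iff₀ hB0, mul_comm, ← div_le_iff₀ (p i)]
    have h2 : m / minRatio d c t i ≤ d i / minRatio d c t i :=
      div_le_div_of_nonneg_right (hmd i) (p i).le
    linarith [hB i]
  · have h := hP.minRatio_eq hd (i - 1)
    rw [sub_add_cancel] at h
    have h1 := div_pos (hd (i - 1)) (p (i - 1))
    have h2 := mul_le_mul_of_nonneg_right (hmd i) (p i).le
    rw [le_div_iff₀ hm]
    linarith [hB (i - 1)]

theorem AllPos.ratioProd_solves (hd : ∀ i, 0 < d i) {t : ℝ} (hP : AllPos d c t) (i : ℤ) :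
    latticeOp d c (ratioProd (minRatio d c t)) i - t * ratioProd (minRatio d c t) i = 0 := by
  have p := hP.minRatio_pos hd
  have h := hP.minRatio_eq hd i
  have h1 := ratioProd_add_one p i
  have h2 := ratioProd_add_one p (i - 1)
  rw [sub_add_cancel] at h2
  have h3 : ratioProd (minRatio d c t) (i - 1)
      = ratioProd (minRatio d c t) i / minRatio d c t i := by
    rw [h2, mul_div_cancel_right₀ _ (p i).ne']
  rw [latticeOp_sub_eq, h1, h3, ← h]
  ring

/-- Lagrange's identity for solutions at two levels. -/
theorem wronskian_step {t t' : ℝ} {u v : ℤ → ℝ} {i : ℤ}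
    (hu : latticeOp d c u i - t * u i = 0) (hv : latticeOp d c v i - t' * v i = 0) :
    d i * (v i * u (i - 1) - v (i - 1) * u i)
      = d (i + 1) * (v (i + 1) * u i - v i * u (i + 1)) + (t - t') * (u i * v i) := by
  rw [latticeOp_sub_eq] at hu hv
  simp only [diagCoeff] at hu hv
  linear_combination (v i) * hu - (u i) * hv

/-- With v the minimal solution at the lower level `t'`, the Wronskian `W` is nonnegative and drops
by (t - t')uv at each step. Hence the sum of uv to the right is finite, and u ≤ v there makes u
square summable. -/
theorem AllPos.isDecayingSolution (hd : ∀ i, 0 < d i) {t t' : ℝ} (h : t' < t)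
    (hP : AllPos d c t') : IsDecayingSolution d c t (ratioProd (minRatio d c t)) := by
  have hPt := hP.mono hd h.le
  refine ⟨hPt.ratioProd_solves hd, ratioProd_zero _, ?_⟩
  set u := ratioProd (minRatio d c t) with hu
  set v := ratioProd (minRatio d c t') with hv
  have pu : ∀ i, 0 < u i := ratioProd_pos _
  have pv : ∀ i, 0 < v i := ratioProd_pos _
  have huv : ∀ n : ℕ, u n ≤ v n := fun n => by
    rw [hu, hv, ratioProd, ratioProd]
    exact Real.exp_le_exp.2 (signedSum_le_of_nonneg (fun i =>
      Real.log_le_log (hPt.minRatio_pos hd i) (hP.minRatio_anti hd h.le i)) n)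
  set W : ℕ → ℝ := fun n => d (n + 1) * (v (n + 1) * u n - v n * u (n + 1)) with hW
  have hW0 : ∀ n, 0 ≤ W n := fun n => by
    have h1 := ratioProd_add_one (hPt.minRatio_pos hd) n
    have h2 := ratioProd_add_one (hP.minRatio_pos hd) n
    have h3 := mul_le_mul_of_nonneg_left (hP.minRatio_anti hd h.le (n + 1))
      (mul_pos (pu n) (pv n)).le
    refine mul_nonneg (hd _).le ?_
    rw [hu, hv, h1, h2, ← hu, ← hv]
    linarith
  have hstep : ∀ n : ℕ, W n = W (n + 1) + (t - t') * (u (n + 1) * v (n + 1)) := fun n => by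
    have := wronskian_step (hPt.ratioProd_solves hd (n + 1)) (hP.ratioProd_solves hd (n + 1))
    rw [add_sub_cancel_right] at this
    simp only [hW]
    push_cast
    exact this
  have hsum : ∀ n : ℕ, (t - t') * ∑ k ∈ Finset.range n, u (k + 1) * v (k + 1) = W 0 - W n := by
    intro n
    induction n with
    | zero => simp
    | succ n ih => rw [Finset.sum_range_succ, mul_add, ih, hstep n]; ring
  have hδ : 0 < t - t' := sub_pos.2 h
  have hsummable : Summable fun n : ℕ => u ((n + 1 : ℕ) : ℤ) ^ 2 := by
    refine summable_of_sum_range_le (c := W 0 / (t - t')) (fun n => sq_nonneg _) fun n => ?_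
    rw [le_div_iff₀ hδ, mul_comm]
    have h1 : ∑ k ∈ Finset.range n, u ((k + 1 : ℕ) : ℤ) ^ 2
        ≤ ∑ k ∈ Finset.range n, u (k + 1) * v (k + 1) := by
      refine Finset.sum_le_sum fun k _ => ?_
      have := mul_le_mul_of_nonneg_left (huv (k + 1)) (pu ((k + 1 : ℕ) : ℤ)).le
      push_cast at this ⊢
      linarith
    have h2 := mul_le_mul_of_nonneg_left h1 hδ.le
    rw [hsum] at h2
    linarith [hW0 n]
  have h1 := (hsummable.tendsto_atTop_zero).sqrt
  simp only [Real.sqrt_sq (pu _).le, Real.sqrt_zero] at h1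
  rw [← Nat.map_cast_int_atTop, tendsto_map'_iff]
  exact (tendsto_add_atTop_iff_nat (f := fun n : ℕ => u n) 1).1 h1

/-- The Wronskian of two solutions at one level is constant, and it tends to 0 because both decay
and `d` is bounded; so the solutions are proportional. -/
theorem IsDecayingSolution.unique (hd : ∀ i, 0 < d i) {M : ℝ} (hM : ∀ i, d i ≤ M) {t : ℝ}
    {u v : ℤ → ℝ} (hu : IsDecayingSolution d c t u) (hpos : ∀ i, 0 < u i)
    (hv : IsDecayingSolution d c t v) : v = u := by
  set W : ℤ → ℝ := fun i => d i * (v i * u (i - 1) - v (i - 1) * u i) with hW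
  have hstep : ∀ i, W i = W (i + 1) := fun i => by
    have := wronskian_step (hu.eqn i) (hv.eqn i)
    simp only [hW, add_sub_cancel_right]
    linarith
  have hconst : ∀ i, W i = W 0 := by
    intro i
    induction i using Int.induction_on with
    | zero => rfl
    | succ n ih => rw [← hstep, ih]
    | pred n ih => rw [hstep, sub_add_cancel, ih]
  have hlim : Tendsto W atTop (𝓝 0) := by
    have hs : Tendsto (fun i : ℤ => i - 1) atTop atTop := tendsto_atTop_add_const_right _ _ tendsto_id
    have h1 := (hv.decay.mul (hu.decay.comp hs)).sub ((hv.decay.comp hs).mul hu.decay)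
    simp only [mul_zero, sub_zero] at h1
    refine bdd_le_mul_tendsto_zero' M (Eventually.of_forall fun i => ?_) h1
    rw [abs_of_pos (hd i)]
    exact hM i
  have hW0 : W 0 = 0 := by
    have : Tendsto W atTop (𝓝 (W 0)) := by
      rw [funext hconst]
      exact tendsto_const_nhds
    exact tendsto_nhds_unique this hlim
  have hcross : ∀ i, v i * u (i - 1) = v (i - 1) * u i := fun i => by
    have := (hconst i).trans hW0
    simp only [hW, mul_eq_zero, (hd i).ne', false_or] at this
    linarith
  have hq : ∀ i, v i / u i = v (i - 1) / u (i - 1) := fun i => by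
    rw [div_eq_div_iff (hpos _).ne' (hpos _).ne', hcross]
  have hq1 : ∀ i, v i / u i = 1 := by
    intro i
    induction i using Int.induction_on with
    | zero => rw [hu.normalized, hv.normalized, div_one]
    | succ n ih => rw [hq, add_sub_cancel_right, ih]
    | pred n ih => rw [← hq, ih]
  funext i
  have := hq1 i
  rwa [div_eq_one_iff_eq (hpos i).ne'] at this

end Deterministic

/-! ### The pointwise ergodic theorem. -/

/-- The maximum of the Birkhoff sums of `h` of length at most `n` (including the empty one). -/
noncomputable def maxBirkhoff {Ω : Type*} (T : Ω → Ω) (h : Ω → ℝ) : ℕ → Ω → ℝ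
  | 0, _ => 0
  | n + 1, x => max 0 (h x + maxBirkhoff T h n (T x))

section Birkhoff

variable {Ω : Type*}

theorem maxBirkhoff_nonneg (T : Ω → Ω) (h : Ω → ℝ) (n : ℕ) (x : Ω) :
    0 ≤ maxBirkhoff T h n x := by
  cases n with
  | zero => exact le_rfl
  | succ n => exact le_max_left _ _

theorem birkhoffSum_le_maxBirkhoff (T : Ω → Ω) (h : Ω → ℝ) (n : ℕ) (x : Ω) :
    birkhoffSum T h n x ≤ maxBirkhoff T h n x := by
  induction n generalizing x with
  | zero => simp [maxBirkhoff]
  | succ n ih =>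
    rw [birkhoffSum_succ', maxBirkhoff]
    exact le_max_of_le_right (by linarith [ih (T x)])

theorem monotone_maxBirkhoff (T : Ω → Ω) (h : Ω → ℝ) (x : Ω) :
    Monotone fun n => maxBirkhoff T h n x := by
  refine monotone_nat_of_le_succ fun n => ?_
  induction n generalizing x with
  | zero => exact maxBirkhoff_nonneg _ _ _ _
  | succ n ih =>
    rw [maxBirkhoff, maxBirkhoff]
    exact max_le_max le_rfl (by linarith [ih (T x)])

variable [MeasurableSpace Ω] {P : Measure Ω} {T : Ω → Ω} {h : Ω → ℝ}

theorem measurable_maxBirkhoff (hT : Measurable T) (hh : Measurable h) (n : ℕ) :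
    Measurable (maxBirkhoff T h n) := by
  induction n with
  | zero => exact measurable_const
  | succ n ih => exact measurable_const.max (hh.add (ih.comp hT))

theorem integrable_maxBirkhoff (hT : MeasurePreserving T P P) (hh : Integrable h P) (n : ℕ) :
    Integrable (maxBirkhoff T h n) P := by
  induction n with
  | zero => exact integrable_zero _ _ _
  | succ n ih =>
    exact (integrable_zero _ _ _).sup (hh.add (hT.integrable_comp_of_integrable ih))

/-- Unboundedness is an invariant event. If it had full measure, the differences M_{n+1} - M_n ∘ T =
max(-M_n ∘ T, h) would converge to h, dominated by |h|. Their integrals are nonnegative because M_n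
increases and T preserves the measure, contradicting the negative mean. -/
theorem Ergodic.ae_bddAbove_maxBirkhoff (hT : Ergodic T P) (hm : Measurable h)
    (hh : Integrable h P) (hneg : ∫ x, h x ∂P < 0) :
    ∀ᵐ x ∂P, ∃ C : ℝ, ∀ n, maxBirkhoff T h n x ≤ C := by
  set E : Set Ω := {x | ∀ N : ℕ, ∃ n, (N : ℝ) < maxBirkhoff T h n x} with hE
  have hEm : MeasurableSet E := by
    have : E = ⋂ N : ℕ, ⋃ n, {x | (N : ℝ) < maxBirkhoff T h n x} := by
      ext x; simp [hE]
    rw [this]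
    exact MeasurableSet.iInter fun N => MeasurableSet.iUnion fun n =>
      measurableSet_lt measurable_const (measurable_maxBirkhoff hT.measurable hm n)
  have hinv : T ⁻¹' E = E := by
    ext x
    simp only [hE, mem_preimage, mem_ofPred_eq]
    constructor
    · intro hx N
      obtain ⟨K, hK⟩ := exists_nat_gt (N - h x)
      obtain ⟨n, hn⟩ := hx K
      exact ⟨n + 1, lt_max_of_lt_right (by linarith)⟩
    · intro hx N
      obtain ⟨K, hK⟩ := exists_nat_gt (N + h x)
      obtain ⟨n, hn⟩ := hx K
      have hn' := hn.trans_le (monotone_maxBirkhoff T h x n.le_succ)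
      simp only [maxBirkhoff, lt_max_iff] at hn'
      refine ⟨n, ?_⟩
      rcases hn' with h1 | h1
      · exact absurd h1 (by simp)
      · linarith
  rcases hT.toPreErgodic.ae_mem_or_ae_notMem hEm hinv with hx | hx
  · exfalso
    have hMP := hT.toMeasurePreserving
    set F : ℕ → Ω → ℝ := fun n x => maxBirkhoff T h (n + 1) x - maxBirkhoff T h n (T x) with hF
    have hFe : ∀ n x, F n x = max (-maxBirkhoff T h n (T x)) (h x) := fun n x => by
      rw [hF]
      simp only [maxBirkhoff]
      rw [← max_sub_sub_right, zero_sub, add_sub_cancel_right]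
    have hint : ∀ n, 0 ≤ ∫ x, F n x ∂P := fun n => by
      have i1 := integrable_maxBirkhoff hMP hh (n + 1)
      have i0 := integrable_maxBirkhoff hMP hh n
      have i2 : Integrable (fun x => maxBirkhoff T h n (T x)) P :=
        hMP.integrable_comp_of_integrable i0
      rw [hF, integral_sub i1 i2]
      have e : ∫ x, maxBirkhoff T h n (T x) ∂P = ∫ x, maxBirkhoff T h n x ∂P := by
        rw [← integral_map hMP.measurable.aemeasurable, hMP.map_eq]
        rw [hMP.map_eq]
        exact i0.aestronglyMeasurable
      rw [e, sub_nonneg]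
      exact integral_mono i0 i1 fun x => monotone_maxBirkhoff T h x n.le_succ
    have hlim : Tendsto (fun n => ∫ x, F n x ∂P) atTop (𝓝 (∫ x, h x ∂P)) := by
      refine tendsto_integral_of_dominated_convergence (fun x => |h x|) (fun n => ?_) hh.abs
        (fun n => Eventually.of_forall fun x => ?_) ?_
      · exact ((measurable_maxBirkhoff hT.measurable hm (n + 1)).sub
          ((measurable_maxBirkhoff hT.measurable hm n).comp hT.measurable)).aestronglyMeasurable
      · rw [hFe, Real.norm_eq_abs, abs_le]
        have := maxBirkhoff_nonneg T h n (T x)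
        exact ⟨(neg_abs_le _).trans (le_max_right _ _),
          max_le (by linarith [abs_nonneg (h x)]) (le_abs_self _)⟩
      · filter_upwards [hx] with x hx
        rw [← hinv] at hx
        obtain ⟨K, hK⟩ := exists_nat_gt (-h x)
        obtain ⟨n, hn⟩ := hx K
        refine tendsto_const_nhds.congr' ?_
        filter_upwards [eventually_ge_atTop n] with k hk
        have := monotone_maxBirkhoff T h (T x) hk
        simp only at this
        rw [hFe, max_eq_right]
        linarith
    exact absurd (ge_of_tendsto' hlim hint) (not_le.2 hneg)
  · filter_upwards [hx] with x hx
    simp only [hE, mem_ofPred_eq, not_forall, not_exists, not_lt] at hx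
    obtain ⟨N, hN⟩ := hx
    exact ⟨N, hN⟩

theorem Ergodic.ae_eventually_birkhoffSum_div_le [IsProbabilityMeasure P] (hT : Ergodic T P)
    (hm : Measurable h) (hh : Integrable h P) {ε : ℝ} (hε : 0 < ε) :
    ∀ᵐ x ∂P, ∀ᶠ n : ℕ in atTop, birkhoffSum T h n x / n ≤ ∫ x, h x ∂P + ε := by
  set a := ∫ x, h x ∂P with ha
  have hneg : ∫ x, (h x - (a + ε / 2)) ∂P < 0 := by
    rw [integral_sub hh (integrable_const _)]
    simp [← ha, hε]
  filter_upwards [hT.ae_bddAbove_maxBirkhoff (hm.sub_const _) (hh.sub (integrable_const _)) hneg]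
    with x ⟨C, hC⟩
  have h1 : ∀ᶠ n : ℕ in atTop, C / n ≤ ε / 2 :=
    (tendsto_const_div_atTop_nhds_zero_nat C).eventually_le_const (by linarith)
  filter_upwards [h1, eventually_gt_atTop 0] with n hn hn0
  have h2 := (birkhoffSum_le_maxBirkhoff T (fun x => h x - (a + ε / 2)) n x).trans (hC n)
  have h3 : birkhoffSum T (fun x => h x - (a + ε / 2)) n x
      = birkhoffSum T h n x - n * (a + ε / 2) := by
    simp only [birkhoffSum, Finset.sum_sub_distrib, Finset.sum_const, Finset.card_range,
      nsmul_eq_mul]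
  have hn' : (0 : ℝ) < n := by exact_mod_cast hn0
  rw [h3] at h2
  rw [div_le_iff₀ hn'] at hn ⊢
  linarith

/-- The pointwise ergodic theorem for an ergodic transformation of a probability space. -/
theorem Ergodic.ae_tendsto_birkhoffSum_div [IsProbabilityMeasure P] (hT : Ergodic T P)
    (hm : Measurable h) (hh : Integrable h P) :
    ∀ᵐ x ∂P, Tendsto (fun n : ℕ => birkhoffSum T h n x / n) atTop (𝓝 (∫ x, h x ∂P)) := by
  have h1 : ∀ᵐ x ∂P, ∀ k : ℕ, ∀ᶠ n : ℕ in atTop,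
      birkhoffSum T h n x / n ≤ ∫ x, h x ∂P + 1 / ((k : ℝ) + 1) :=
    ae_all_iff.2 fun k => hT.ae_eventually_birkhoffSum_div_le hm hh Nat.one_div_pos_of_nat
  have h2 : ∀ᵐ x ∂P, ∀ k : ℕ, ∀ᶠ n : ℕ in atTop,
      birkhoffSum T (fun x => -h x) n x / n ≤ ∫ x, -h x ∂P + 1 / ((k : ℝ) + 1) :=
    ae_all_iff.2 fun k => hT.ae_eventually_birkhoffSum_div_le hm.neg hh.neg Nat.one_div_pos_of_nat
  filter_upwards [h1, h2] with x h1 h2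
  rw [Metric.tendsto_atTop']
  intro ε hε
  obtain ⟨k, hk⟩ := exists_nat_one_div_lt hε
  obtain ⟨N, hN⟩ := eventually_atTop.1 ((h1 k).and (h2 k))
  refine ⟨N, fun n hn => ?_⟩
  obtain ⟨a1, a2⟩ := hN n hn.le
  have e : birkhoffSum T (fun x => -h x) n x = -birkhoffSum T h n x := by
    simp [birkhoffSum]
  rw [e, integral_neg, neg_div] at a2
  rw [Real.dist_eq, abs_lt]
  constructor <;> linarith

end Birkhoff

/-! ### Stationary coefficients, the threshold and Birkhoff sums of log ratios. -/

/-- The values of a random variable along the orbit of `ω`. -/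
def orbitSeq {Ω : Type*} [AddAction ℤ Ω] (D : Ω → ℝ) (ω : Ω) (i : ℤ) : ℝ := D (i +ᵥ ω)

theorem orbitSeq_vadd {Ω : Type*} [AddAction ℤ Ω] (D : Ω → ℝ) (j : ℤ) (ω : Ω) :
    orbitSeq D (j +ᵥ ω) = fun i => orbitSeq D ω (i + j) := by
  funext i
  simp only [orbitSeq, vadd_vadd]

theorem posBox_orbitSeq_vadd {Ω : Type*} [AddAction ℤ Ω] (D C : Ω → ℝ) (t : ℝ) (j l : ℤ) (k : ℕ)
    (ω : Ω) : PosBox (orbitSeq D (j +ᵥ ω)) (orbitSeq C (j +ᵥ ω)) t l k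
      ↔ PosBox (orbitSeq D ω) (orbitSeq C ω) t (l + j) k := by
  simp only [PosBox, orbitSeq_vadd, dirichletSol_shift]

section Deterministic

variable {d c : ℤ → ℝ}

theorem PosBox.subbox (hd : ∀ i, 0 < d i) {t : ℝ} {l l' : ℤ} {k k' : ℕ}
    (hP : PosBox d c t l k) (h1 : l ≤ l') (h2 : l' + k' ≤ l + k) : PosBox d c t l' k' := by
  obtain ⟨m, rfl⟩ : ∃ m : ℕ, l' = l + m := ⟨(l' - l).toNat, by omega⟩
  exact PosBox.drop hd m (hP.mono_right (by omega))

theorem tendsto_principalEigenvalue (hd : ∀ i, 0 < d i) {K : ℝ} (hc : ∀ i, c i ≤ K) {Γ : ℝ}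
    {l : ℕ → ℤ} {k : ℕ → ℕ} (hk : ∀ n, n ≤ k n) (h1 : ∀ t, Γ < t → AllPos d c t)
    (h2 : ∀ a < Γ, ∃ q > a, ∀ᶠ n in atTop, ¬ PosBox d c q (l n) (k n)) :
    Tendsto (fun n => principalEigenvalue d c (l n) (k n)) atTop (𝓝 Γ) := by
  refine tendsto_order.2 ⟨fun a ha => ?_, fun b hb => ?_⟩
  · obtain ⟨q, hq, h⟩ := h2 a ha
    filter_upwards [h, eventually_ge_atTop 1] with n hn hn1
    rw [← principalEigenvalue_lt_iff hd hc (hn1.trans (hk n)), not_lt] at hn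
    exact lt_of_lt_of_le hq hn
  · filter_upwards [eventually_ge_atTop 1] with n hn1
    exact (principalEigenvalue_lt_iff hd hc (hn1.trans (hk n))).2 (h1 b hb _ _)

end Deterministic

/-- Monotone dependence on a parameter upgrades convergence at rational parameters to
convergence at all parameters, if the limit is continuous. -/
theorem tendsto_of_rat_of_continuousOn {Γ : ℝ} {μ : ℝ → ℝ} {F : ℝ → ℕ → ℝ}
    (hmono : ∀ s t, Γ < s → s ≤ t → ∀ n, F s n ≤ F t n) (hcont : ContinuousOn μ (Ioi Γ))
    (hrat : ∀ q : ℚ, Γ < q → Tendsto (F q) atTop (𝓝 (μ q))) {t : ℝ} (ht : Γ < t) :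
    Tendsto (F t) atTop (𝓝 (μ t)) := by
  have hc : ContinuousAt μ t := hcont.continuousAt (Ioi_mem_nhds ht)
  refine tendsto_order.2 ⟨fun a ha => ?_, fun b hb => ?_⟩
  · obtain ⟨ε, hε, h⟩ := Metric.eventually_nhds_iff.1 (hc.eventually (lt_mem_nhds ha))
    obtain ⟨q, hq1, hq2⟩ := exists_rat_btwn (max_lt ht (sub_lt_self t hε))
    have hqΓ := (le_max_left _ _).trans_lt hq1
    have hqε := (le_max_right _ _).trans_lt hq1
    have hq : a < μ q := h (by rw [Real.dist_eq, abs_lt]; constructor <;> linarith)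
    filter_upwards [(hrat q hqΓ).eventually (lt_mem_nhds hq)] with n hn
    exact hn.trans_le (hmono _ _ hqΓ hq2.le n)
  · obtain ⟨ε, hε, h⟩ := Metric.eventually_nhds_iff.1 (hc.eventually (gt_mem_nhds hb))
    obtain ⟨q, hq1, hq2⟩ := exists_rat_btwn (lt_add_of_pos_right t hε)
    have hq : μ q < b := h (by rw [Real.dist_eq, abs_lt]; constructor <;> linarith)
    filter_upwards [(hrat q (ht.trans hq1)).eventually (gt_mem_nhds hq)] with n hn
    exact (hmono _ _ ht hq1.le n).trans_lt hn

section Shift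

variable {Ω : Type*} [MeasurableSpace Ω] {P : Measure Ω}
  [AddAction ℤ Ω] [MeasurableConstVAdd ℤ Ω] [ErgodicVAdd ℤ Ω P]

theorem ergodic_one_vadd : Ergodic (fun ω : Ω => (1 : ℤ) +ᵥ ω) P where
  toMeasurePreserving := measurePreserving_vadd 1 P
  aeconst_set s hs hinv := by
    have h1 : ∀ ω : Ω, (1 : ℤ) +ᵥ ω ∈ s ↔ ω ∈ s := fun ω => by
      conv_rhs => rw [← hinv]
      rfl
    refine ErgodicVAdd.aeconst_of_forall_preimage_vadd_ae_eq (G := ℤ) hs fun n => ?_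
    have : (fun ω : Ω => n +ᵥ ω) ⁻¹' s = s := by
      ext ω
      rw [mem_preimage]
      induction n using Int.induction_on with
      | zero => rw [zero_vadd]
      | succ n ih => rw [add_comm, ← vadd_vadd, h1, ih]
      | pred n ih => rw [← h1, vadd_vadd, add_sub_cancel, ih]
    exact this.eventuallyEq

theorem ergodic_neg_one_vadd : Ergodic (fun ω : Ω => (-1 : ℤ) +ᵥ ω) P where
  toMeasurePreserving := measurePreserving_vadd (-1) P
  aeconst_set s hs hinv := by
    refine (ergodic_one_vadd (P := P)).aeconst_set hs ?_
    conv_lhs => rw [← hinv]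
    ext ω
    simp [vadd_vadd]

theorem ae_forall_vadd {p : Ω → Prop} (h : ∀ᵐ ω ∂P, p ω) : ∀ᵐ ω ∂P, ∀ j : ℤ, p (j +ᵥ ω) :=
  ae_all_iff.2 fun j => (measurePreserving_vadd j P).quasiMeasurePreserving.ae h

end Shift

section Stationary

variable {Ω : Type*} [AddAction ℤ Ω] {D C : Ω → ℝ}

theorem allPos_of_forall_right {t : ℝ} {ω : Ω}
    (h : ∀ j : ℤ, ∀ k, PosBox (orbitSeq D (j +ᵥ ω)) (orbitSeq C (j +ᵥ ω)) t 0 k) :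
    AllPos (orbitSeq D ω) (orbitSeq C ω) t := fun l k => by
  have := h l k
  rwa [posBox_orbitSeq_vadd, zero_add] at this

theorem allPos_of_forall_left {t : ℝ} {ω : Ω}
    (h : ∀ j : ℤ, ∀ k : ℕ, PosBox (orbitSeq D (j +ᵥ ω)) (orbitSeq C (j +ᵥ ω)) t (-k) k) :
    AllPos (orbitSeq D ω) (orbitSeq C ω) t := fun l k => by
  have := h (l + k) k
  rwa [posBox_orbitSeq_vadd, show -(k : ℤ) + (l + k) = l by ring] at this

/-- Minus the logarithm of the ratio `u_0 / u_{-1}` of the solution minimal at `+∞`. -/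
noncomputable def decayIncrement (D C : Ω → ℝ) (t : ℝ) (ω : Ω) : ℝ :=
  -Real.log (minRatio (orbitSeq D ω) (orbitSeq C ω) t 0)

/-- Shift covariance turns the log ratios into values of a single random variable along the orbit.
-/
theorem log_minRatio_orbitSeq (t : ℝ) (ω : Ω) (i : ℤ) :
    Real.log (minRatio (orbitSeq D ω) (orbitSeq C ω) t i) = -decayIncrement D C t (i +ᵥ ω) := by
  rw [decayIncrement, orbitSeq_vadd, orbitSeq_vadd, minRatio_shift, zero_add, neg_neg]

variable [MeasurableSpace Ω] [MeasurableConstVAdd ℤ Ω]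

theorem measurable_orbitSeq (hD : Measurable D) (i : ℤ) : Measurable fun ω => orbitSeq D ω i :=
  hD.comp (measurable_const_vadd i)

theorem measurable_diagCoeff (hD : Measurable D) (hC : Measurable C) (t : ℝ) (i : ℤ) :
    Measurable fun ω => diagCoeff (orbitSeq D ω) (orbitSeq C ω) t i :=
  (((measurable_const).sub (measurable_orbitSeq hC i)).add (measurable_orbitSeq hD _)).add
    (measurable_orbitSeq hD _)

theorem measurable_dirichletSol (hD : Measurable D) (hC : Measurable C) (t : ℝ) (l : ℤ) (n : ℕ) :
    Measurable fun ω => dirichletSol (orbitSeq D ω) (orbitSeq C ω) t l n := by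
  induction n using Nat.twoStepInduction with
  | zero => exact measurable_const
  | one => exact measurable_const
  | more n h1 h2 =>
    exact (((measurable_diagCoeff hD hC t _).mul h2).sub ((measurable_orbitSeq hD _).mul h1)).div
      (measurable_orbitSeq hD _)

theorem measurableSet_posBox (hD : Measurable D) (hC : Measurable C) (t : ℝ) (l : ℤ) (k : ℕ) :
    MeasurableSet {ω | PosBox (orbitSeq D ω) (orbitSeq C ω) t l k} := by
  have : {ω | PosBox (orbitSeq D ω) (orbitSeq C ω) t l k}
      = ⋂ j : ℕ, ⋂ _ : j ≤ k, {ω | 0 < dirichletSol (orbitSeq D ω) (orbitSeq C ω) t l (j + 1)} := by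
    ext ω; simp [PosBox]
  rw [this]
  exact MeasurableSet.iInter fun j => MeasurableSet.iInter fun _ =>
    measurableSet_lt measurable_const (measurable_dirichletSol hD hC t l (j + 1))

theorem measurable_riccati (hD : Measurable D) (hC : Measurable C) (t : ℝ) (n : ℕ) (i : ℤ) :
    Measurable fun ω => riccati (orbitSeq D ω) (orbitSeq C ω) t n i := by
  induction n generalizing i with
  | zero => exact measurable_const
  | succ n ih =>
    exact (measurable_orbitSeq hD _).div ((measurable_diagCoeff hD hC t _).sub
      ((measurable_orbitSeq hD _).mul (ih _)))

theorem measurable_decayIncrement (hD : Measurable D) (hC : Measurable C) (t : ℝ) :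
    Measurable (decayIncrement D C t) :=
  (Real.measurable_log.comp (Measurable.iSup fun n => measurable_riccati hD hC t n 0)).neg

variable {P : Measure Ω} [IsProbabilityMeasure P]

theorem integrable_decayIncrement (hDm : Measurable D) (hCm : Measurable C) {m M K : ℝ}
    (hm : 0 < m) (hmD : ∀ ω, m ≤ D ω) (hDM : ∀ ω, D ω ≤ M) (hCK : ∀ ω, |C ω| ≤ K) {t : ℝ}
    (h : ∀ᵐ ω ∂P, AllPos (orbitSeq D ω) (orbitSeq C ω) t) :
    Integrable (decayIncrement D C t) P := by
  have hd : ∀ ω i, 0 < orbitSeq D ω i := fun ω i => hm.trans_le (hmD _)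
  set B := t + K + 2 * M with hB
  refine Integrable.of_bound (measurable_decayIncrement hDm hCm t).aestronglyMeasurable
    (|Real.log (m / B)| + |Real.log (B / m)|) ?_
  filter_upwards [h] with ω hω
  have hdiag : ∀ i, diagCoeff (orbitSeq D ω) (orbitSeq C ω) t i ≤ B := fun i => by
    have h2 := (abs_le.1 (hCK (i +ᵥ ω))).1
    have h3 := hDM (i +ᵥ ω)
    have h4 := hDM ((i + 1) +ᵥ ω)
    simp only [diagCoeff, orbitSeq]
    linarith
  have hB0 : 0 < B := (hω.diagCoeff_pos (hd ω) 0).trans_le (hdiag 0)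
  obtain ⟨h1, h2⟩ := hω.minRatio_bounds (hd ω) hm (fun i => hmD _) hdiag 0
  have h3 := Real.log_le_log (div_pos hm hB0) h1
  have h4 := Real.log_le_log (hω.minRatio_pos (hd ω) 0) h2
  rw [decayIncrement, norm_neg, Real.norm_eq_abs, abs_le]
  have := neg_abs_le (Real.log (m / B))
  have := le_abs_self (Real.log (B / m))
  have := abs_nonneg (Real.log (m / B))
  have := abs_nonneg (Real.log (B / m))
  constructor <;> linarith

variable [ErgodicVAdd ℤ Ω P]

theorem ae_allPos_or (hDm : Measurable D) (hCm : Measurable C) (hD : ∀ ω, 0 < D ω) (t : ℝ) :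
    (∀ᵐ ω ∂P, AllPos (orbitSeq D ω) (orbitSeq C ω) t) ∨
      ∀ᵐ ω ∂P, (∃ k, ¬ PosBox (orbitSeq D ω) (orbitSeq C ω) t 0 k) ∧
        ∃ k : ℕ, ¬ PosBox (orbitSeq D ω) (orbitSeq C ω) t (-k) k := by
  have hd : ∀ ω i, 0 < orbitSeq D ω i := fun ω i => hD _
  set A : Set Ω := {ω | ∀ k, PosBox (orbitSeq D ω) (orbitSeq C ω) t 0 k} with hA
  set B : Set Ω := {ω | ∀ k : ℕ, PosBox (orbitSeq D ω) (orbitSeq C ω) t (-k) k} with hB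
  have hAm : MeasurableSet A := by
    have : A = ⋂ k, {ω | PosBox (orbitSeq D ω) (orbitSeq C ω) t 0 k} := by ext; simp [hA]
    rw [this]
    exact MeasurableSet.iInter fun k => measurableSet_posBox hDm hCm t 0 k
  have hBm : MeasurableSet B := by
    have : B = ⋂ k : ℕ, {ω | PosBox (orbitSeq D ω) (orbitSeq C ω) t (-k) k} := by ext; simp [hB]
    rw [this]
    exact MeasurableSet.iInter fun k => measurableSet_posBox hDm hCm t (-k) k
  -- Shrinking boxes gives only an inclusion, which suffices for the zero-one law on a probability
  -- space. Every box is a translate of one in `A` and of one in `B`, so full measure of either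
  -- event makes all boxes positive.
  have hA1 : A ⊆ (fun ω => (1 : ℤ) +ᵥ ω) ⁻¹' A := fun ω hω k => by
    rw [posBox_orbitSeq_vadd]
    exact PosBox.subbox (hd ω) (hω (k + 1)) (by norm_num) (by push_cast; linarith)
  have hB1 : B ⊆ (fun ω => (-1 : ℤ) +ᵥ ω) ⁻¹' B := fun ω hω k => by
    rw [posBox_orbitSeq_vadd]
    exact PosBox.subbox (hd ω) (hω (k + 1)) (by push_cast; linarith) (by push_cast; linarith)
  rcases (ergodic_one_vadd (P := P)).ae_empty_or_univ_of_ae_le_preimage hAm.nullMeasurableSet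
    (Eventually.of_forall hA1) with hA0 | hA0
  · rcases (ergodic_neg_one_vadd (P := P)).ae_empty_or_univ_of_ae_le_preimage hBm.nullMeasurableSet
      (Eventually.of_forall hB1) with hB0 | hB0
    · right
      rw [ae_eq_empty, measure_eq_zero_iff_ae_notMem] at hA0 hB0
      filter_upwards [hA0, hB0] with ω h1 h2
      exact ⟨not_forall.1 h1, not_forall.1 h2⟩
    · left
      rw [ae_eq_univ, ← mem_ae_iff] at hB0
      filter_upwards [ae_forall_vadd (p := fun ω => ω ∈ B) hB0] with ω hω
      exact allPos_of_forall_left hω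
  · left
    rw [ae_eq_univ, ← mem_ae_iff] at hA0
    filter_upwards [ae_forall_vadd (p := fun ω => ω ∈ A) hA0] with ω hω
    exact allPos_of_forall_right hω

/-- The almost sure threshold between positive and oscillating Dirichlet solutions. -/
theorem exists_threshold (hDm : Measurable D) (hCm : Measurable C) {m M K : ℝ} (hm : 0 < m)
    (hmD : ∀ ω, m ≤ D ω) (hDM : ∀ ω, D ω ≤ M) (hCK : ∀ ω, |C ω| ≤ K) :
    ∃ Γ : ℝ, (∀ᵐ ω ∂P, ∀ t, Γ < t → AllPos (orbitSeq D ω) (orbitSeq C ω) t) ∧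
      ∀ᵐ ω ∂P, ∀ q : ℚ, q < Γ → (∃ k, ¬ PosBox (orbitSeq D ω) (orbitSeq C ω) q 0 k) ∧
        ∃ k : ℕ, ¬ PosBox (orbitSeq D ω) (orbitSeq C ω) q (-k) k := by
  have hD : ∀ ω, 0 < D ω := fun ω => hm.trans_le (hmD ω)
  have hd : ∀ ω i, 0 < orbitSeq D ω i := fun ω i => hD _
  set S : Set ℝ := {t | ∀ᵐ ω ∂P, AllPos (orbitSeq D ω) (orbitSeq C ω) t} with hS
  have hne : S.Nonempty :=
    ⟨K, show ∀ᵐ ω ∂P, AllPos (orbitSeq D ω) (orbitSeq C ω) K from Eventually.of_forall fun ω =>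
      posBox_of_ge (hd ω) fun i => (le_abs_self _).trans (hCK _)⟩
  have hbdd : BddBelow S := by
    refine ⟨-K - 2 * M, fun t ht => ?_⟩
    obtain ⟨ω, hω⟩ := (show ∀ᵐ ω ∂P, AllPos (orbitSeq D ω) (orbitSeq C ω) t from ht).exists
    have h1 := hω.diagCoeff_pos (hd ω) 0
    simp only [diagCoeff, orbitSeq] at h1
    have h2 := (abs_le.1 (hCK ((0 : ℤ) +ᵥ ω))).1
    have h3 := hDM ((0 : ℤ) +ᵥ ω)
    have h4 := hDM (((0 : ℤ) + 1) +ᵥ ω)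
    linarith
  refine ⟨sInf S, ?_, ?_⟩
  -- Rational levels give a countable intersection of events; monotonicity in the level fills in the
  -- rest.
  · have h : ∀ᵐ ω ∂P, ∀ q : ℚ, sInf S < q → AllPos (orbitSeq D ω) (orbitSeq C ω) q := by
      refine ae_all_iff.2 fun q => ?_
      by_cases hq : sInf S < q
      · obtain ⟨t, ht, htq⟩ := exists_lt_of_csInf_lt hne hq
        filter_upwards [show ∀ᵐ ω ∂P, AllPos (orbitSeq D ω) (orbitSeq C ω) t from ht] with ω hω _
        exact hω.mono (hd ω) htq.le
      · exact Eventually.of_forall fun ω h => absurd h hq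
    filter_upwards [h] with ω hω t ht
    obtain ⟨q, hq1, hq2⟩ := exists_rat_btwn ht
    exact (hω q hq1).mono (hd ω) hq2.le
  · refine ae_all_iff.2 fun q => ?_
    by_cases hq : (q : ℝ) < sInf S
    · have hqS : (q : ℝ) ∉ S := fun h => (csInf_le hbdd h).not_gt hq
      filter_upwards [(ae_allPos_or (P := P) hDm hCm hD (q : ℝ)).resolve_left hqS] with ω hω _
      exact hω
    · exact Eventually.of_forall fun ω h => absurd h hq

theorem ae_tendsto_signedSum (hDm : Measurable D) (hCm : Measurable C) {t : ℝ}
    (hint : Integrable (decayIncrement D C t) P) :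
    ∀ᵐ ω ∂P,
      Tendsto (fun n : ℕ => -signedSum (fun j => Real.log (minRatio (orbitSeq D ω) (orbitSeq C ω)
        t j)) n / n) atTop (𝓝 (∫ ω, decayIncrement D C t ω ∂P)) ∧
      Tendsto (fun n : ℕ => signedSum (fun j => Real.log (minRatio (orbitSeq D ω) (orbitSeq C ω)
        t j)) (-n) / n) atTop (𝓝 (∫ ω, decayIncrement D C t ω ∂P)) := by
  have hmeas := measurable_decayIncrement hDm hCm t
  have hE1 := ergodic_one_vadd (P := P)
  have hE2 := ergodic_neg_one_vadd (P := P)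
  have hMP := hE1.toMeasurePreserving
  -- The sum to the right starts at index 1, so its Birkhoff sum is that of the shifted increment,
  -- with the same mean; the sum to the left starts at index 0.
  have hint1 : Integrable (fun ω => decayIncrement D C t ((1 : ℤ) +ᵥ ω)) P :=
    hMP.integrable_comp_of_integrable hint
  have e : ∫ ω, decayIncrement D C t ((1 : ℤ) +ᵥ ω) ∂P = ∫ ω, decayIncrement D C t ω ∂P := by
    have h := integral_map (μ := P) hMP.measurable.aemeasurable
      (hmeas.stronglyMeasurable.aestronglyMeasurable (μ := P.map fun ω => (1 : ℤ) +ᵥ ω))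
    rw [hMP.map_eq] at h
    exact h.symm
  filter_upwards [hE1.ae_tendsto_birkhoffSum_div (hmeas.comp hMP.measurable) hint1,
    hE2.ae_tendsto_birkhoffSum_div hmeas hint] with ω h1 h2
  simp only [Function.comp_apply, e] at h1
  refine ⟨h1.congr fun n => ?_, h2.congr fun n => ?_⟩
  · rw [signedSum_natCast, ← Finset.sum_neg_distrib, birkhoffSum]
    congr 1
    refine Finset.sum_congr rfl fun k _ => ?_
    rw [vadd_iterate_apply, log_minRatio_orbitSeq, neg_neg, Function.comp_apply, vadd_vadd]
    congr 2
    simp [add_comm]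
  · rw [signedSum_neg_natCast, ← Finset.sum_neg_distrib, birkhoffSum]
    congr 1
    refine Finset.sum_congr rfl fun k _ => ?_
    rw [vadd_iterate_apply, log_minRatio_orbitSeq, neg_neg]
    congr 2
    simp

end Stationary

/-! ### Properties of the decay rate and the main result under deterministic bounds. -/

section Stationary

variable {Ω : Type*} [AddAction ℤ Ω] {D C : Ω → ℝ} [MeasurableSpace Ω] {P : Measure Ω}

theorem integral_decayIncrement_lt [NeZero P] {s t : ℝ} (hst : s < t) (hD : ∀ ω, 0 < D ω)
    (h : ∀ᵐ ω ∂P, AllPos (orbitSeq D ω) (orbitSeq C ω) s)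
    (hs : Integrable (decayIncrement D C s) P) (ht : Integrable (decayIncrement D C t) P) :
    ∫ ω, decayIncrement D C s ω ∂P < ∫ ω, decayIncrement D C t ω ∂P := by
  have hlt : ∀ᵐ ω ∂P, decayIncrement D C s ω < decayIncrement D C t ω := by
    filter_upwards [h] with ω hω
    have hd : ∀ i, 0 < orbitSeq D ω i := fun i => hD _
    exact neg_lt_neg (Real.log_lt_log ((hω.mono hd hst.le).minRatio_pos hd 0)
      (hω.minRatio_lt hd hst 0))
  refine lt_of_le_of_ne (integral_mono_ae hs ht (hlt.mono fun _ => le_of_lt)) fun heq => ?_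
  have h0 := (integral_eq_iff_of_ae_le hs ht (hlt.mono fun _ => le_of_lt)).1 heq
  obtain ⟨ω, h1, h2⟩ := (hlt.and h0).exists
  exact h1.ne h2

theorem integral_decayIncrement_concave {t₁ t₂ a b : ℝ} (ha : 0 ≤ a) (hb : 0 ≤ b)
    (hab : a + b = 1) (hD : ∀ ω, 0 < D ω)
    (h₁ : ∀ᵐ ω ∂P, AllPos (orbitSeq D ω) (orbitSeq C ω) t₁)
    (h₂ : ∀ᵐ ω ∂P, AllPos (orbitSeq D ω) (orbitSeq C ω) t₂)
    (h₃ : ∀ᵐ ω ∂P, AllPos (orbitSeq D ω) (orbitSeq C ω) (a * t₁ + b * t₂))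
    (i₁ : Integrable (decayIncrement D C t₁) P) (i₂ : Integrable (decayIncrement D C t₂) P)
    (i₃ : Integrable (decayIncrement D C (a * t₁ + b * t₂)) P) :
    a * ∫ ω, decayIncrement D C t₁ ω ∂P + b * ∫ ω, decayIncrement D C t₂ ω ∂P
      ≤ ∫ ω, decayIncrement D C (a * t₁ + b * t₂) ω ∂P := by
  rw [← integral_const_mul, ← integral_const_mul,
    ← integral_add (i₁.const_mul a) (i₂.const_mul b)]
  refine integral_mono_ae ((i₁.const_mul a).add (i₂.const_mul b)) i₃ ?_
  filter_upwards [h₁, h₂, h₃] with ω w₁ w₂ w₃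
  have hd : ∀ i, 0 < orbitSeq D ω i := fun i => hD _
  have p₁ := w₁.minRatio_pos hd 0
  have p₂ := w₂.minRatio_pos hd 0
  have h := Real.log_le_log (w₃.minRatio_pos hd 0) (minRatio_convex hd w₁ w₂ ha hb hab 0)
  rw [Real.log_mul (Real.rpow_pos_of_pos p₁ a).ne' (Real.rpow_pos_of_pos p₂ b).ne',
    Real.log_rpow p₁, Real.log_rpow p₂] at h
  simp only [decayIncrement]
  linarith

variable [IsProbabilityMeasure P]

theorem tendsto_integral_decayIncrement {M K : ℝ} (hD : ∀ ω, 0 < D ω) (hDM : ∀ ω, D ω ≤ M)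
    (hCK : ∀ ω, |C ω| ≤ K) (hint : ∀ᶠ t in atTop, Integrable (decayIncrement D C t) P) :
    Tendsto (fun t => ∫ ω, decayIncrement D C t ω ∂P) atTop atTop := by
  obtain ⟨ω₀⟩ : Nonempty Ω := P.nonempty_of_neZero
  have hM : 0 < M := (hD ω₀).trans_le (hDM ω₀)
  have hlim : Tendsto (fun t : ℝ => Real.log ((t - K) / M)) atTop atTop :=
    Real.tendsto_log_atTop.comp
      ((tendsto_atTop_add_const_right _ (-K) tendsto_id).atTop_div_const hM)
  refine tendsto_atTop_mono' _ ?_ hlim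
  filter_upwards [hint, eventually_gt_atTop K] with t ht hK
  have hle : ∀ ω, Real.log ((t - K) / M) ≤ decayIncrement D C t ω := fun ω => by
    have hd : ∀ i, 0 < orbitSeq D ω i := fun i => hD _
    have hc : ∀ i, orbitSeq C ω i ≤ K := fun i => (le_abs_self _).trans (hCK _)
    have hP : AllPos (orbitSeq D ω) (orbitSeq C ω) t :=
      posBox_of_ge hd fun i => (hc i).trans hK.le
    have h1 := minRatio_le_div hd (fun i => (hc i).trans_lt hK) 0
    have h2 : orbitSeq D ω 0 / (t - orbitSeq C ω 0) ≤ M / (t - K) :=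
      div_le_div₀ hM.le (hDM _) (sub_pos.2 hK) (by linarith [hc 0])
    have h3 := Real.log_le_log (hP.minRatio_pos hd 0) (h1.trans h2)
    rw [← inv_div, Real.log_inv]
    exact neg_le_neg h3
  calc Real.log ((t - K) / M) = ∫ _, Real.log ((t - K) / M) ∂P := by simp
    _ ≤ _ := integral_mono (integrable_const _) ht hle

variable [MeasurableConstVAdd ℤ Ω] [ErgodicVAdd ℤ Ω P]

/-- The main result for stationary coefficients with deterministic bounds. -/
theorem exists_limit_and_decayRate (hDm : Measurable D) (hCm : Measurable C) {m M K : ℝ}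
    (hm : 0 < m) (hmD : ∀ ω, m ≤ D ω) (hDM : ∀ ω, D ω ≤ M) (hCK : ∀ ω, |C ω| ≤ K) :
    ∃ Γ : ℝ, IsLimitPrincipalEigenvalue P (fun i ω => orbitSeq D ω i) (fun i ω => orbitSeq C ω i) Γ ∧
      ∃ μ : ℝ → ℝ,
        (∀ᵐ ω ∂P, ∀ γ : ℝ, Γ < γ →
          ∃ u : ℤ → ℝ, IsDecayingSolution (orbitSeq D ω) (orbitSeq C ω) γ u ∧
            (∀ v : ℤ → ℝ, IsDecayingSolution (orbitSeq D ω) (orbitSeq C ω) γ v → v = u) ∧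
            (∀ i, 0 < u i) ∧
            Tendsto (fun i : ℤ => -Real.log (u i) / (i : ℝ)) atTop (𝓝 (μ γ)) ∧
            Tendsto (fun i : ℤ => -Real.log (u i) / (i : ℝ)) atBot (𝓝 (μ γ))) ∧
        StrictMonoOn μ (Ioi Γ) ∧ ConcaveOn ℝ (Ioi Γ) μ ∧ Tendsto μ atTop atTop := by
  have hD : ∀ ω, 0 < D ω := fun ω => hm.trans_le (hmD ω)
  have hd : ∀ ω i, 0 < orbitSeq D ω i := fun ω i => hD _
  obtain ⟨Γ, hΓ1, hΓ2⟩ := exists_threshold (P := P) hDm hCm hm hmD hDM hCK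
  have hpos : ∀ t, Γ < t → ∀ᵐ ω ∂P, AllPos (orbitSeq D ω) (orbitSeq C ω) t := fun t ht =>
    hΓ1.mono fun ω h => h t ht
  have hint : ∀ t, Γ < t → Integrable (decayIncrement D C t) P := fun t ht =>
    integrable_decayIncrement hDm hCm hm hmD hDM hCK (hpos t ht)
  set μ : ℝ → ℝ := fun t => ∫ ω, decayIncrement D C t ω ∂P with hμ
  have hconc : ConcaveOn ℝ (Ioi Γ) μ := by
    refine ⟨convex_Ioi Γ, fun t₁ h₁ t₂ h₂ a b ha hb hab => ?_⟩
    have h₃ := convex_Ioi Γ h₁ h₂ ha hb hab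
    simp only [smul_eq_mul] at h₃ ⊢
    exact integral_decayIncrement_concave ha hb hab hD (hpos _ h₁) (hpos _ h₂) (hpos _ h₃)
      (hint _ h₁) (hint _ h₂) (hint _ h₃)
  have hcont : ContinuousOn μ (Ioi Γ) := hconc.continuousOn isOpen_Ioi
  refine ⟨Γ, ?_, μ, ?_, fun s hs t ht hst => integral_decayIncrement_lt hst hD (hpos s hs)
    (hint s hs) (hint t ht), hconc, tendsto_integral_decayIncrement hD hDM hCK
      ((eventually_gt_atTop Γ).mono hint)⟩
  · filter_upwards [hΓ1, hΓ2] with ω h1 h2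
    have hc : ∀ i, orbitSeq C ω i ≤ K := fun i => (le_abs_self _).trans (hCK _)
    refine ⟨tendsto_principalEigenvalue (hd ω) hc (l := fun n => -(n : ℤ)) (k := fun n => 2 * n)
      (fun n => by omega) h1 fun a ha => ?_,
      tendsto_principalEigenvalue (hd ω) hc (l := fun n => -(n : ℤ)) (k := fun n => n)
      (fun n => le_rfl) h1 fun a ha => ?_,
      tendsto_principalEigenvalue (hd ω) hc (l := fun _ => 0) (k := fun n => n)
      (fun n => le_rfl) h1 fun a ha => ?_⟩
    -- Below the threshold a fixed box next to 0 is bad at a rational level above `a`, and every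
    -- sufficiently large box of each of the three kinds contains it.
    all_goals
      obtain ⟨q, hq1, hq2⟩ := exists_rat_btwn ha
      obtain ⟨⟨k₁, hk₁⟩, k₂, hk₂⟩ := h2 q hq2
      refine ⟨q, hq1, ?_⟩
    · filter_upwards [eventually_ge_atTop k₁] with n hn hP
      exact hk₁ (hP.subbox (hd ω) (by omega) (by push_cast; omega))
    · filter_upwards [eventually_ge_atTop k₂] with n hn hP
      exact hk₂ (hP.subbox (hd ω) (by omega) (by omega))
    · filter_upwards [eventually_ge_atTop k₁] with n hn hP
      exact hk₁ (hP.mono_right hn)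
  · have hrat : ∀ᵐ ω ∂P, ∀ q : ℚ, Γ < q → _ := ae_all_iff.2 fun q : ℚ =>
      (eventually_imp_distrib_left (p := Γ < q)).2 fun hq =>
        ae_tendsto_signedSum (P := P) hDm hCm (hint q hq)
    filter_upwards [hΓ1, hrat] with ω h1 h2 γ hγ
    -- An intermediate level provides the comparison solution in the proof of decay.
    obtain ⟨γ', hγ1, hγ2⟩ := exists_between hγ
    have hsol := (h1 γ' hγ1).isDecayingSolution (hd ω) hγ2
    have hlog : ∀ s t, Γ < s → s ≤ t → ∀ i,
        Real.log (minRatio (orbitSeq D ω) (orbitSeq C ω) t i)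
          ≤ Real.log (minRatio (orbitSeq D ω) (orbitSeq C ω) s i) := fun s t hs hst i =>
      Real.log_le_log ((h1 t (hs.trans_le hst)).minRatio_pos (hd ω) i)
        ((h1 s hs).minRatio_anti (hd ω) hst i)
    refine ⟨_, hsol, fun v hv => hsol.unique (hd ω) (fun i => hDM _) (ratioProd_pos _) hv,
      ratioProd_pos _, ?_, ?_⟩
    · rw [← Nat.map_cast_int_atTop, tendsto_map'_iff]
      simp only [Function.comp_def, log_ratioProd, Int.cast_natCast]
      refine tendsto_of_rat_of_continuousOn (F := fun t n => -signedSum (fun j =>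
        Real.log (minRatio (orbitSeq D ω) (orbitSeq C ω) t j)) n / n)
        (fun s t hs hst n => ?_) hcont (fun q hq => (h2 q hq).1) hγ
      exact div_le_div_of_nonneg_right
        (neg_le_neg (signedSum_le_of_nonneg (hlog s t hs hst) n)) n.cast_nonneg
    · have h3 := tendsto_of_rat_of_continuousOn (F := fun t n => signedSum (fun j =>
        Real.log (minRatio (orbitSeq D ω) (orbitSeq C ω) t j)) (-n) / n)
        (fun s t hs hst n => div_le_div_of_nonneg_right
          (signedSum_neg_ge (hlog s t hs hst) n) n.cast_nonneg) hcont (fun q hq => (h2 q hq).2) hγ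
      have h4 : Tendsto (fun i : ℤ => -Real.log (ratioProd (minRatio (orbitSeq D ω)
          (orbitSeq C ω) γ) (-i)) / ((-i : ℤ) : ℝ)) atTop (𝓝 (μ γ)) := by
        rw [← Nat.map_cast_int_atTop, tendsto_map'_iff]
        simp only [Function.comp_def, log_ratioProd, Int.cast_neg, Int.cast_natCast, neg_div_neg_eq]
        exact h3
      have h5 := h4.comp tendsto_neg_atBot_atTop
      simpa only [Function.comp_def, neg_neg] using h5

/-! ### Reduction to measurable coefficients with deterministic bounds. -/

/-- Almost surely finite invariant bounds of a stationary sequence are deterministic. -/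
theorem exists_ae_bound_of_ergodic {X : Ω → ℝ} (hX : Measurable X)
    (h : ∀ᵐ ω ∂P, ∃ N : ℝ, ∀ i : ℤ, X (i +ᵥ ω) ≤ N) : ∃ N : ℝ, ∀ᵐ ω ∂P, X ω ≤ N := by
  set E : ℕ → Set Ω := fun N => {ω | ∀ i : ℤ, X (i +ᵥ ω) ≤ N} with hE
  have hEm : ∀ N, MeasurableSet (E N) := fun N => by
    have : E N = ⋂ i : ℤ, {ω | X (i +ᵥ ω) ≤ N} := by ext; simp [hE]
    rw [this]
    exact MeasurableSet.iInter fun i =>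
      measurableSet_le (hX.comp (measurable_const_vadd i)) measurable_const
  have hinv : ∀ N, (fun ω : Ω => (1 : ℤ) +ᵥ ω) ⁻¹' E N = E N := fun N => by
    ext ω
    simp only [hE, mem_preimage, mem_ofPred_eq, vadd_vadd]
    exact ⟨fun h i => by simpa using h (i - 1), fun h i => h (i + 1)⟩
  by_contra! hcon
  -- Each `E N` is invariant. If none had full measure all would be null, although almost every
  -- point lies in one of them.
  have hnot : ∀ N, ∀ᵐ ω ∂P, ω ∉ E N := fun N => by
    refine ((ergodic_one_vadd (P := P)).toPreErgodic.ae_mem_or_ae_notMem (hEm N)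
      (hinv N)).resolve_left fun h1 => hcon N ?_
    filter_upwards [h1] with ω hω
    simpa using hω 0
  obtain ⟨ω, ⟨N, hN⟩, h2⟩ := (h.and (ae_all_iff.2 hnot)).exists
  obtain ⟨k, hk⟩ := exists_nat_ge N
  exact h2 k fun i => (hN i).trans hk

end Stationary

/-- The derivative at 0 is almost surely the limit of the difference quotients at 1/(n+1), which are
measurable. -/
theorem aemeasurable_growthRate {Ω : Type*} [MeasurableSpace Ω] {P : Measure Ω}
    {f : ℤ → ℝ → Ω → ℝ} {i : ℤ} (hf : ∀ s ∈ Icc (0 : ℝ) 1, Measurable (f i s))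
    (hdiff : ∀ᵐ ω ∂P, DifferentiableWithinAt ℝ (fun s => f i s ω) (Icc 0 1) 0) :
    AEMeasurable (fun ω => growthRate (fun i s => f i s ω) i) P := by
  have hmem : ∀ n : ℕ, (1 : ℝ) / ((n : ℝ) + 1) ∈ Icc (0 : ℝ) 1 \ {0} := fun n =>
    ⟨⟨Nat.one_div_pos_of_nat.le, (div_le_one (by positivity)).2 (by linarith [n.cast_nonneg (α := ℝ)])⟩,
      (Nat.one_div_pos_of_nat (α := ℝ)).ne'⟩
  have hlim : Tendsto (fun n : ℕ => (1 : ℝ) / ((n : ℝ) + 1)) atTop (𝓝[Icc (0 : ℝ) 1 \ {0}] 0) :=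
    tendsto_nhdsWithin_iff.2 ⟨tendsto_one_div_add_atTop_nhds_zero_nat, Eventually.of_forall hmem⟩
  refine aemeasurable_of_tendsto_metrizable_ae' (f := fun (n : ℕ) ω =>
    slope (fun s => f i s ω) 0 (1 / ((n : ℝ) + 1))) (fun n => ?_) ?_
  · simp only [slope_def_field]
    exact (((hf _ (hmem n).1).sub (hf 0 (by simp))).div_const _).aemeasurable
  · filter_upwards [hdiff] with ω hω
    exact (hasDerivWithinAt_iff_tendsto_slope.1 hω.hasDerivWithinAt).comp hlim

theorem theorem6p2 {Ω : Type*} [MeasurableSpace Ω] (P : Measure Ω) [IsProbabilityMeasure P]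
    [AddAction ℤ Ω] [MeasurableConstVAdd ℤ Ω] [ErgodicVAdd ℤ Ω P]
    (α : ℝ) (hα : α ∈ Ioc (0 : ℝ) 1)
    (f : ℤ → ℝ → Ω → ℝ) (d c : ℤ → Ω → ℝ)
    (hf : ∀ i, ∀ s ∈ Icc (0 : ℝ) 1, Measurable (f i s))
    (hd : ∀ i, Measurable (d i))
    (hKPP : ∀ᵐ ω ∂P, IsKPPRealization α (fun i s => f i s ω) (d · ω))
    (hc : ∀ᵐ ω ∂P, ∀ i, c i ω = growthRate (fun i s => f i s ω) i)
    (hc_stat : ∀ᵐ ω ∂P, ∀ i j : ℤ, c (i + j) ω = c i (j +ᵥ ω))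
    (hd_stat : ∀ᵐ ω ∂P, ∀ i j : ℤ, d (i + j) ω = d i (j +ᵥ ω)) :
    ∃ Γ : ℝ, IsLimitPrincipalEigenvalue P d c Γ ∧
      ∃ μ : ℝ → ℝ,
        (∀ᵐ ω ∂P, ∀ γ : ℝ, Γ < γ →
          ∃ u : ℤ → ℝ, IsDecayingSolution (d · ω) (c · ω) γ u ∧
            (∀ v : ℤ → ℝ, IsDecayingSolution (d · ω) (c · ω) γ v → v = u) ∧
            (∀ i, 0 < u i) ∧
            Tendsto (fun i : ℤ => -Real.log (u i) / (i : ℝ)) atTop (𝓝 (μ γ)) ∧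
            Tendsto (fun i : ℤ => -Real.log (u i) / (i : ℝ)) atBot (𝓝 (μ γ))) ∧
        StrictMonoOn μ (Ioi Γ) ∧
        ConcaveOn ℝ (Ioi Γ) μ ∧
        Tendsto μ atTop atTop := by
  have hc0 : AEMeasurable (c 0) P := by
    refine (aemeasurable_growthRate (hf 0) (hKPP.mono fun ω h => ?_)).congr
      (hc.mono fun ω h => (h 0).symm)
    exact (h.contDiff 0).differentiableOn one_ne_zero 0 (by simp)
  -- As the shifts preserve the measure, the measurable version agrees with `c 0` almost surely
  -- along the whole orbit.
  set C₀ := hc0.mk (c 0) with hC₀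
  have hC₀m : Measurable C₀ := hc0.measurable_mk
  have hdorb : ∀ᵐ ω ∂P, ∀ i, d i ω = d 0 (i +ᵥ ω) := hd_stat.mono fun ω h i => by
    rw [← h 0 i, zero_add]
  have hcorb : ∀ᵐ ω ∂P, ∀ i, c i ω = C₀ (i +ᵥ ω) := by
    filter_upwards [hc_stat, ae_forall_vadd hc0.ae_eq_mk] with ω h1 h2 i
    rw [hC₀, ← h2 i, ← h1 0 i, zero_add]
  obtain ⟨M, hM⟩ := exists_ae_bound_of_ergodic (P := P) (hd 0) (by
    filter_upwards [hKPP, hdorb] with ω h1 h2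
    obtain ⟨M, hM⟩ := h1.sup_d_finite
    exact ⟨M, fun i => by rw [← h2 i]; exact hM i⟩)
  -- A positive lower bound for `d` is an upper bound for its inverse.
  obtain ⟨L, hL⟩ := exists_ae_bound_of_ergodic (P := P) (hd 0).inv (by
    filter_upwards [hKPP, hdorb] with ω h1 h2
    obtain ⟨m, hm, hmd⟩ := h1.inf_d_pos
    exact ⟨m⁻¹, fun i => by
      rw [Pi.inv_apply, ← h2 i]
      exact inv_anti₀ hm (hmd i)⟩)
  obtain ⟨K, hK⟩ := exists_ae_bound_of_ergodic (P := P) hC₀m.abs (by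
    filter_upwards [hKPP, hcorb, hc] with ω h1 h2 h3
    obtain ⟨K, hK⟩ := h1.holder
    exact ⟨K, fun i => by
      rw [← h2 i, h3 i]
      exact (hK i 0 (by simp)).2.1⟩)
  have hdpos : ∀ᵐ ω ∂P, 0 < d 0 ω := hKPP.mono fun ω h => by
    obtain ⟨m, hm, hmd⟩ := h.inf_d_pos
    exact hm.trans_le (hmd 0)
  obtain ⟨ω₀, w1, w2, w3, w4⟩ := (hM.and (hL.and (hK.and hdpos))).exists
  have hL0 : 0 < L := (inv_pos.2 w4).trans_le w2
  have hM0 : L⁻¹ ≤ M := (inv_le_of_inv_le₀ w4 w2).trans w1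
  have hK0 : 0 ≤ K := (abs_nonneg _).trans w3
  -- Clamping makes the bounds hold at every point and changes nothing almost surely. The point `ω₀`
  -- served to show that the clamping intervals are nonempty.
  set D : Ω → ℝ := fun ω => max L⁻¹ (min M (d 0 ω)) with hDdef
  set C : Ω → ℝ := fun ω => max (-K) (min K (C₀ ω)) with hCdef
  have hDeq : ∀ᵐ ω ∂P, d 0 ω = D ω := by
    filter_upwards [hM, hL, hdpos] with ω h1 h2 h3
    simp only [hDdef]
    rw [min_eq_right h1, max_eq_right (inv_le_of_inv_le₀ h3 h2)]
  have hCeq : ∀ᵐ ω ∂P, C₀ ω = C ω := by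
    filter_upwards [hK] with ω h
    simp only [hCdef]
    rw [min_eq_right (abs_le.1 h).2, max_eq_right (abs_le.1 h).1]
  have hdD : ∀ᵐ ω ∂P, (d · ω) = orbitSeq D ω := by
    filter_upwards [hdorb, ae_forall_vadd hDeq] with ω h1 h2
    funext i
    rw [h1, h2, orbitSeq]
  have hcC : ∀ᵐ ω ∂P, (c · ω) = orbitSeq C ω := by
    filter_upwards [hcorb, ae_forall_vadd hCeq] with ω h1 h2
    funext i
    rw [h1, h2, orbitSeq]
  obtain ⟨Γ, hΓ, μ, hμ, hμ'⟩ := exists_limit_and_decayRate (P := P) (D := D) (C := C)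
    (measurable_const.max (measurable_const.min (hd 0)))
    (measurable_const.max (measurable_const.min hC₀m)) (inv_pos.2 hL0)
    (fun ω => le_max_left _ _) (fun ω => max_le hM0 (min_le_left _ _))
    (K := K) (fun ω => abs_le.2 ⟨le_max_left _ _, max_le (by linarith) (min_le_left _ _)⟩)
  refine ⟨Γ, ?_, μ, ?_, hμ'⟩
  · filter_upwards [hΓ, hdD, hcC] with ω h1 h2 h3
    rw [h2, h3]
    exact h1
  · filter_upwards [hμ, hdD, hcC] with ω h1 h2 h3
    rw [h2, h3]
    exact h1
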